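/- **Theorem (Uniqueness for periodic spatial domains $\mathbb T^d$).** Let $d\ge 1$, $\mathbb T^d=(\mathbb R/\mathbb Z)^d$, $D=\mathbb T^d\times\mathbb S^{d-1}$ with the product $dx\,d\omega$ of Lebesgue and surface measure, $\mu>0$ and $T>0$. Let $\nu:[-1,1]\to\mathbb R$ be smooth (hence bounded), let $K$ be a real function with $K(|\cdot|)\in L^1(\mathbb T^d)$, where $|z|$ is the flat distance of $z\in\mathbb T^d$ to $0$, and let $f_0\in (L^1\cap L^\infty)(D)$ with $f_0\ge 0$. Consider $$\partial_t f+\omega\cdot\nabla_x f=-\nabla_\omega\cdot(fF_o)+\mu\Delta_\omega f,\qquad f|_{t=0}=f_0,$$ $$F_o=\nu(\omega\cdot\Omega(f))\,(\mathrm{Id}-\omega\otimes\omega)\,\Omega(f),\qquad \Omega(f)=\frac{J(f)}{|J(f)|},\qquad J(f)(x,t)=\int_{D}K(|x-y|)\,\omega f(y,\omega,t)\,dy\,d\omega .$$ A weak solution on $[0,T]$ is a function $f\ge 0$ with $f\in C([0,T];L^1(D))\cap L^\infty(D\times(0,T))$ and weak spherical gradient $\nabla_\omega f\in L^2(D\times(0,T))$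 such that, for every $\phi\in C_c^\infty(D\times[0,T))$, $$\int_0^T\!\!\int_D \big(f\,\partial_t\phi+f\,\omega\cdot\nabla_x\phi+fF_o\cdot\nabla_\omega\phi-\mu\nabla_\omega f\cdot\nabla_\omega\phi\big)\,dx\,d\omega\,dt+\int_D f_0\,\phi(\cdot,\cdot,0)\,dx\,d\omega=0 .$$ Let $\mathcal A_\alpha$ be the class of those $f$ for which there is $\alpha>0$ with $|J(f)(x,t)|>\alpha$ for all $(x,t)\in\mathbb T^d\times(0,T)$. Then weak solutions in $\mathcal A_\alpha$ are unique: if $f$ and $g$ are weak solutions on $[0,T]$ with the same initial datum $f_0$ and both belong to $\mathcal A_\alpha$ (possibly with different constants $\alpha$), then $f(\cdot,\cdot,t)=g(\cdot,\cdot,t)$ almost everywhere on $D$ for every $t\in[0,T]$. -/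

import Mathlib

open MeasureTheory Filter Topology
open scoped ContDiff ENNReal

noncomputable section

namespace KolmogorovVicsek

/-- The ambient Euclidean space `ℝ^d`. -/
abbrev Vec (d : ℕ) : Type := EuclideanSpace ℝ (Fin d)

/-- The flat torus `𝕋^d = (ℝ/ℤ)^d`. -/
abbrev Torus (d : ℕ) : Type := Fin d → UnitAddCircle

/-- The unit sphere `𝕊^{d-1}` of `ℝ^d`. -/
abbrev Sph (d : ℕ) : Type := Metric.sphere (0 : Vec d) 1

/-- The phase space `D = 𝕋^d × 𝕊^{d-1}`, with points `(x, ω)`. -/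
abbrev Phase (d : ℕ) : Type := Torus d × Sph d

/-- The quotient map `ℝ^d → 𝕋^d`. -/
def toTorus {d : ℕ} (v : Vec d) : Torus d := fun i => ((v i : ℝ) : UnitAddCircle)

/-- The flat (Euclidean) distance `|z|` of `z ∈ 𝕋^d` to the origin; `|x - y|` is
`torusNorm (x - y)`. -/
def torusNorm {d : ℕ} (z : Torus d) : ℝ := √(∑ i, ‖z i‖ ^ 2)

/-- The measure `dx dω` on `D`: Lebesgue measure on the torus times surface measure on the
sphere. -/
def phaseMeasure (d : ℕ) : Measure (Phase d) :=
  (volume : Measure (Torus d)).prod (volume : Measure (Vec d)).toSphere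

/-- The measure `dt dx dω` on `(0,T) × D`. -/
def spaceTimeMeasure (d : ℕ) (T : ℝ) : Measure (ℝ × Phase d) :=
  (volume.restrict (Set.Ioo 0 T)).prod (phaseMeasure d)

/-- The projection `(Id - w ⊗ w) v`. -/
def proj {d : ℕ} (w v : Vec d) : Vec d := v - inner ℝ w v • w

/-- Test functions `φ ∈ C_c^∞(D × [0,T))`. A smooth function on `[0,T) × 𝕋^d × 𝕊^{d-1}` is
presented as the restriction of a smooth function of `(t, x, ω) ∈ ℝ × 𝕋^d × ℝ^d` (every smooth
function has such an extension, and all expressions below depend only on the restriction);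
smoothness in `x ∈ 𝕋^d` is smoothness of the periodic lift. As `D` is compact, compact support
in `D × [0,T)` means vanishing for `t` close to `T`. -/
structure IsTestFunction {d : ℕ} (T : ℝ) (φ : ℝ → Torus d → Vec d → ℝ) : Prop where
  smooth : ContDiff ℝ ∞ (fun p : ℝ × Vec d × Vec d => φ p.1 (toTorus p.2.1) p.2.2)
  support : ∃ T' < T, ∀ t, T' ≤ t → ∀ x w, φ t x w = 0

/-- The time derivative `∂_t φ`. -/
def timeDeriv {d : ℕ} (φ : ℝ → Torus d → Vec d → ℝ) (t : ℝ) (p : Phase d) : ℝ :=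
  deriv (fun s : ℝ => φ s p.1 p.2) t

/-- The transport derivative `ω · ∇_x φ`, the derivative of `φ` along `x + s ω` at `s = 0`. -/
def transportDeriv {d : ℕ} (φ : ℝ → Torus d → Vec d → ℝ) (t : ℝ) (p : Phase d) : ℝ :=
  deriv (fun s : ℝ => φ t (p.1 + toTorus (s • (p.2 : Vec d))) p.2) 0

/-- The spherical gradient `∇_ω φ`, the tangential part of the Euclidean gradient in `ω`. -/
def sphereGrad {d : ℕ} (φ : ℝ → Torus d → Vec d → ℝ) (t : ℝ) (p : Phase d) : Vec d :=
  proj p.2 (gradient (fun v : Vec d => φ t p.1 v) p.2)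

/-- `G` is the weak (distributional) spherical gradient `∇_ω f` on `(0,T) × D`. On the sphere
integration by parts reads `∫ ψ ∇_ω f dω = ∫ f ((d-1) ψ ω - ∇_ω ψ) dω`; this is the definition
of `∇_ω f` by duality with the tangential fields `(Id - ω ⊗ ω)(ψ e_i)`, whose spherical
divergence is `(∇_ω ψ - (d-1) ψ ω) · e_i`, and it forces `G` to be tangential. -/
def IsWeakSphereGrad {d : ℕ} (T : ℝ) (f : ℝ → Phase d → ℝ) (G : ℝ → Phase d → Vec d) : Prop :=
  ∀ ψ : ℝ → Torus d → Vec d → ℝ, IsTestFunction T ψ →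
    ∫ q : ℝ × Phase d, ψ q.1 q.2.1 q.2.2 • G q.1 q.2 ∂(spaceTimeMeasure d T) =
      ∫ q : ℝ × Phase d, f q.1 q.2 •
        ((((d : ℝ) - 1) * ψ q.1 q.2.1 q.2.2) • (q.2.2 : Vec d) - sphereGrad ψ q.1 q.2)
          ∂(spaceTimeMeasure d T)

/-- The momentum `J(f)(x,t) = ∫ K(|x - y|) ω f(y,ω,t) dy dω`. -/
def momentum {d : ℕ} (K : ℝ → ℝ) (f : ℝ → Phase d → ℝ) (x : Torus d) (t : ℝ) : Vec d :=
  ∫ p : Phase d, (K (torusNorm (x - p.1)) * f t p) • (p.2 : Vec d) ∂(phaseMeasure d)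

/-- The direction `Ω(f) = J(f) / |J(f)|` (only used where `J(f) ≠ 0`). -/
def direction {d : ℕ} (K : ℝ → ℝ) (f : ℝ → Phase d → ℝ) (x : Torus d) (t : ℝ) : Vec d :=
  ‖momentum K f x t‖⁻¹ • momentum K f x t

/-- The alignment force `F_o(x,ω,t) = ν(ω · Ω(f)) (Id - ω ⊗ ω) Ω(f)`. -/
def force {d : ℕ} (ν K : ℝ → ℝ) (f : ℝ → Phase d → ℝ) (t : ℝ) (p : Phase d) : Vec d :=
  ν (inner ℝ (p.2 : Vec d) (direction K f p.1 t)) • proj p.2 (direction K f p.1 t)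

/-- `f` is a weak solution on `[0,T]`, with initial datum `f₀`, of
`∂_t f + ω · ∇_x f = - ∇_ω · (f F_o) + μ Δ_ω f` on the torus: `f ≥ 0`,
`f ∈ C([0,T]; L¹(D)) ∩ L^∞(D × (0,T))`, `∇_ω f ∈ L²(D × (0,T))`, and the weak formulation holds
for all test functions. -/
structure IsWeakSolution {d : ℕ} (μ : ℝ) (ν K : ℝ → ℝ) (T : ℝ) (f₀ : Phase d → ℝ)
    (f : ℝ → Phase d → ℝ) : Prop where
  nonneg : ∀ᵐ q ∂(spaceTimeMeasure d T), 0 ≤ f q.1 q.2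
  integrable : ∀ t ∈ Set.Icc 0 T, Integrable (f t) (phaseMeasure d)
  continuous : ∀ t₀ ∈ Set.Icc 0 T,
    Tendsto (fun t => ∫ p, |f t p - f t₀ p| ∂(phaseMeasure d)) (𝓝[Set.Icc 0 T] t₀) (𝓝 0)
  bounded : MemLp (fun q : ℝ × Phase d => f q.1 q.2) ∞ (spaceTimeMeasure d T)
  weak_form : ∃ G : ℝ → Phase d → Vec d,
    MemLp (fun q : ℝ × Phase d => G q.1 q.2) 2 (spaceTimeMeasure d T) ∧
    IsWeakSphereGrad T f G ∧
    ∀ φ : ℝ → Torus d → Vec d → ℝ, IsTestFunction T φ →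
      ∫ q : ℝ × Phase d,
          (f q.1 q.2 * timeDeriv φ q.1 q.2 + f q.1 q.2 * transportDeriv φ q.1 q.2
            + f q.1 q.2 * inner ℝ (force ν K f q.1 q.2) (sphereGrad φ q.1 q.2)
            - μ * inner ℝ (G q.1 q.2) (sphereGrad φ q.1 q.2)) ∂(spaceTimeMeasure d T)
        + ∫ p : Phase d, f₀ p * φ 0 p.1 p.2 ∂(phaseMeasure d) = 0

/-- The class `𝒜_α`: the momentum is bounded away from zero, `|J(f)(x,t)| > α` for all
`(x,t) ∈ 𝕋^d × (0,T)`, for some `α > 0`. -/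
def IsAdmissible {d : ℕ} (K : ℝ → ℝ) (T : ℝ) (f : ℝ → Phase d → ℝ) : Prop :=
  ∃ α : ℝ, 0 < α ∧ ∀ x : Torus d, ∀ t ∈ Set.Ioo 0 T, α < ‖momentum K f x t‖

end KolmogorovVicsek

end

/-!
The difference `u = f - g` of two weak solutions solves the linear equation
`∂_t u + ω · ∇_x u = - ∇_ω · h + μ Δ_ω u` with zero initial datum and source
`h = f F_o(f) - g F_o(g)`. Uniqueness follows from the energy inequality
`∫ u(t)² ≤ (2μ)⁻¹ ∫_0^t ∫ |h|²` (`IsLinearWeakSolution.energy_le`), the Lipschitz estimate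
`∫ |h(t)|² ≤ C ∫ u(t)²` (`exists_integral_sq_flux_sub_le`) and Grönwall's inequality
(`ae_eq_zero_of_le_integral`); continuity in time with values in `L¹` passes from almost every time
to every time (`ae_eq_of_ae_ae_eq`).

The Lipschitz estimate is where the lower bound on the momenta enters: normalisation is Lipschitz
away from the origin, `ν` is bounded and Lipschitz on `[-1, 1]`, and `J(f) - J(g)` is controlled in
`L²` by Young's inequality, as `K(|·|)` is integrable.

The energy inequality cannot be obtained by testing the equation with `u`, which need not have
derivatives in `x` or `t`. Instead the equation is tested with the modes `χ(t) trig(k · x) m_I(ω)`,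
where the `m_I` are monomials with `∑_I m_I(p) m_I(q) = (1 + p · q) ^ n` (`sum_sphMono_mul`). Each
moment of `u` against a mode is absolutely continuous in time, so its square may be differentiated.
For a given wave vector `k`, the sum of the squares over `I` is the quadratic form of averaging in
`ω` against a zonal kernel, and three properties of this kernel replace a spectral decomposition on
the sphere:

* divided by its mass it is a symmetric approximate identity, so that as `n → ∞` the energies of
  the modes with wave vector `k` converge to the energy of the `k`-th Fourier coefficients in `x`
  (`tendsto_kernelDefect`); Parseval's identity then recovers `∫ u²`;
* it commutes with rotations, so that the rotation fields `ω_i ∂_j - ω_j ∂_i`, which express the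
  spherical gradient, can be moved between the two factors and the diffusion absorbs the source by
  completing a square (`sum_integral_mode_mul_inner_le`);
* transport only enters through the antisymmetric factor `ω_p - ω_q`, on which the kernel
  concentrates no mass in the limit (`sum_integral_mode_mul_modeTransport_le`,
  `tendsto_zonalSpread`). For fixed `k` this commutator therefore vanishes as `n → ∞`.
-/

namespace KolmogorovVicsek

/-! ### The zonal kernel on the sphere -/

section

open scoped Pointwise

/-- The surface measure on `𝕊^{d-1}`. -/
noncomputable abbrev sphMeasure (d : ℕ) : Measure (Sph d) := (volume : Measure (Vec d)).toSphere

/-- The action of a linear isometry of `ℝ^d` on the unit sphere. -/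
noncomputable def sphMap {d : ℕ} (e : Vec d ≃ₗᵢ[ℝ] Vec d) (p : Sph d) : Sph d :=
  ⟨e p, by simp⟩

lemma continuous_sphMap {d : ℕ} (e : Vec d ≃ₗᵢ[ℝ] Vec d) : Continuous (sphMap e) :=
  Continuous.subtype_mk (e.continuous.comp continuous_subtype_val) _

lemma measurePreserving_sphMap {d : ℕ} (e : Vec d ≃ₗᵢ[ℝ] Vec d) :
    MeasurePreserving (sphMap e) (sphMeasure d) (sphMeasure d) := by
  refine ⟨(continuous_sphMap e).measurable, ?_⟩
  ext s hs
  rw [Measure.map_apply (continuous_sphMap e).measurable hs,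
    Measure.toSphere_apply' _ ((continuous_sphMap e).measurable hs),
    Measure.toSphere_apply' _ hs]
  congr 1
  rw [← e.measurePreserving.measure_preimage_emb e.toHomeomorph.measurableEmbedding
    (Set.Ioo (0 : ℝ) 1 • ((↑) '' s : Set (Vec d)))]
  congr 1
  ext v
  simp only [Set.mem_smul, Set.mem_image, Set.mem_preimage]
  constructor
  · rintro ⟨r, hr, _, ⟨p, hp, rfl⟩, rfl⟩
    exact ⟨r, hr, _, ⟨_, hp, rfl⟩, (map_smul e r (p : Vec d)).symm⟩
  · rintro ⟨r, hr, _, ⟨p, hp, rfl⟩, h⟩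
    have hp' : sphMap e (sphMap e.symm p) = p := Subtype.ext (e.apply_symm_apply _)
    refine ⟨r, hr, _, ⟨sphMap e.symm p, by rwa [hp'], rfl⟩, e.injective ?_⟩
    rw [map_smul]
    refine Eq.trans ?_ h
    exact congrArg (fun w : Sph d => r • (w : Vec d)) hp'

lemma exists_sphMap_eq {d : ℕ} (p q : Sph d) : ∃ e : Vec d ≃ₗᵢ[ℝ] Vec d, sphMap e p = q :=
  ⟨_, Subtype.ext (Submodule.reflection_sub (v := (p : Vec d)) (w := q) (by simp))⟩

lemma one_add_inner_nonneg {d : ℕ} (p q : Sph d) : 0 ≤ 1 + inner ℝ (p : Vec d) (q : Vec d) := by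
  have := (abs_le.1 (abs_real_inner_le_norm (p : Vec d) (q : Vec d))).1
  simp at this; linarith

/-- The total mass `∫ (1 + p · q) ^ n dq` of the zonal kernel. -/
noncomputable def zonalMass (d n : ℕ) (p : Sph d) : ℝ :=
  ∫ q : Sph d, (1 + inner ℝ (p : Vec d) (q : Vec d)) ^ n ∂(sphMeasure d)

lemma zonalMass_eq {d : ℕ} (n : ℕ) (p q : Sph d) : zonalMass d n p = zonalMass d n q := by
  obtain ⟨e, rfl⟩ := exists_sphMap_eq q p
  have h := measurePreserving_sphMap e
  have hc : Continuous fun r : Sph d =>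
      (1 + inner ℝ ((sphMap e q : Sph d) : Vec d) (r : Vec d)) ^ n := by fun_prop
  rw [zonalMass, zonalMass]
  conv_lhs => rw [← h.map_eq, integral_map h.measurable.aemeasurable hc.aestronglyMeasurable]
  exact integral_congr_ae (.of_forall fun r => by
    simp only [sphMap, LinearIsometryEquiv.inner_map_map])

lemma continuous_zonal {d : ℕ} (n : ℕ) :
    Continuous fun z : Sph d × Sph d => (1 + inner ℝ (z.1 : Vec d) (z.2 : Vec d)) ^ n := by
  fun_prop

lemma zonalMass_pos {d : ℕ} (n : ℕ) (p : Sph d) : 0 < zonalMass d n p := by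
  have hc : Continuous fun r : Sph d => (1 + inner ℝ (p : Vec d) (r : Vec d)) ^ n := by fun_prop
  refine hc.integral_pos_of_hasCompactSupport_nonneg_nonzero (HasCompactSupport.of_compactSpace _)
    (fun q => pow_nonneg (one_add_inner_nonneg p q) n) (x := p) ?_
  simp

/-- The normalised zonal kernels are an approximate identity on the sphere. -/
lemma tendsto_zonal_average {d : ℕ} (p : Sph d) {g : Sph d → ℝ} (hg : Continuous g) :
    Tendsto (fun n : ℕ => (zonalMass d n p)⁻¹ *
      ∫ q, (1 + inner ℝ (p : Vec d) (q : Vec d)) ^ n * g q ∂(sphMeasure d)) atTop (𝓝 (g p)) := by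
  have := tendsto_setIntegral_pow_smul_of_unique_maximum_of_isCompact_of_continuousOn
    (μ := sphMeasure d) (s := Set.univ) (x₀ := p) (g := g) isCompact_univ
    (c := fun q : Sph d => 1 + inner ℝ (p : Vec d) (q : Vec d))
    (Continuous.continuousOn (by fun_prop)) ?_
    (fun q _ => one_add_inner_nonneg p q) ?_ (by simp) hg.continuousOn
  · simpa only [zonalMass, setIntegral_univ, smul_eq_mul] using this
  · intro q _ hq
    have : inner ℝ (p : Vec d) (q : Vec d) < 1 :=
      inner_lt_one_iff_real_of_norm_eq_one (by simp) (by simp) |>.2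
        fun h => hq (Subtype.ext h.symm)
    simpa [real_inner_self_eq_norm_sq] using this
  · simp

/-- The quadratic defect `½ ∫∫ w(p,q) (v p - v q)²` measuring how far averaging against the
symmetric kernel `w` is from the identity. -/
noncomputable def kernelDefect {X : Type*} [MeasurableSpace X] (σ : Measure X) (w : X × X → ℝ)
    (v : X → ℝ) : ℝ :=
  2⁻¹ * ∫ z, w z * (v z.1 - v z.2) ^ 2 ∂(σ.prod σ)

/-! ### Averaging against symmetric kernels -/

section Kernel

set_option linter.unusedSectionVars false

variable {X : Type*} [TopologicalSpace X] [CompactSpace X] [SecondCountableTopology X]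
  [MeasurableSpace X] [BorelSpace X] {σ : Measure X} [IsFiniteMeasure σ] {w : X × X → ℝ}

lemma integrable_kernel_mul (hw : Continuous w) {F : X × X → ℝ} (hF : Integrable F (σ.prod σ)) :
    Integrable (fun z => w z * F z) (σ.prod σ) := by
  obtain ⟨C, hC⟩ := (isCompact_range hw).isBounded.exists_norm_le
  exact hF.bdd_mul hw.aestronglyMeasurable (.of_forall fun z => hC _ ⟨z, rfl⟩)

lemma integral_kernel_fst (hw : Continuous w) (hmass : ∀ p, ∫ q, w (p, q) ∂σ = 1)
    {F : X → ℝ} (hF : Integrable F σ) :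
    ∫ z, w z * F z.1 ∂(σ.prod σ) = ∫ p, F p ∂σ := by
  rw [integral_prod _ (integrable_kernel_mul hw (hF.comp_fst σ))]
  refine integral_congr_ae (.of_forall fun p => ?_)
  simp only [integral_mul_const, hmass, one_mul]

lemma integral_kernel_snd (hw : Continuous w) (hmass : ∀ p, ∫ q, w (p, q) ∂σ = 1)
    (hsymm : ∀ p q, w (p, q) = w (q, p)) {F : X → ℝ} (hF : Integrable F σ) :
    ∫ z, w z * F z.2 ∂(σ.prod σ) = ∫ p, F p ∂σ := by
  rw [← integral_kernel_fst hw hmass hF, ← integral_prod_swap]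
  exact integral_congr_ae (.of_forall fun z => by
    obtain ⟨a, b⟩ := z
    simp [hsymm a b])

/-- For a symmetric kernel of mass one, the associated quadratic form is `‖v‖²` minus the defect. -/
lemma integral_kernel_mul_mul (hw : Continuous w) (hmass : ∀ p, ∫ q, w (p, q) ∂σ = 1)
    (hsymm : ∀ p q, w (p, q) = w (q, p)) {v : X → ℝ} (hv : MemLp v 2 σ) :
    ∫ z, w z * (v z.1 * v z.2) ∂(σ.prod σ) = ∫ p, v p ^ 2 ∂σ - kernelDefect σ w v := by
  have hv2 : Integrable (fun p => v p ^ 2) σ := hv.integrable_sq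
  have hv1 : Integrable v σ := hv.integrable (by norm_num)
  have e1 := integral_kernel_fst hw hmass hv2
  have e2 := integral_kernel_snd hw hmass hsymm hv2
  have i1 := integrable_kernel_mul hw (hv2.comp_fst σ)
  have i2 := integrable_kernel_mul hw (hv2.comp_snd σ)
  have i3 := integrable_kernel_mul hw (hv1.mul_prod hv1)
  have : ∀ z : X × X, w z * (v z.1 - v z.2) ^ 2 =
      w z * v z.1 ^ 2 + w z * v z.2 ^ 2 - 2 * (w z * (v z.1 * v z.2)) := fun z => by ring
  simp only [kernelDefect, this]
  have i12 : Integrable (fun z => w z * v z.1 ^ 2 + w z * v z.2 ^ 2) (σ.prod σ) := i1.add i2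
  rw [integral_sub i12 (i3.const_mul 2), integral_add i1 i2, integral_const_mul, e1, e2]
  ring

lemma kernelDefect_nonneg (hw0 : ∀ z, 0 ≤ w z) (v : X → ℝ) : 0 ≤ kernelDefect σ w v :=
  mul_nonneg (by norm_num) (integral_nonneg fun z => mul_nonneg (hw0 z) (sq_nonneg _))

lemma integrable_kernel_sub_sq (hw : Continuous w) {v : X → ℝ} (hv : MemLp v 2 σ) :
    Integrable (fun z => w z * (v z.1 - v z.2) ^ 2) (σ.prod σ) :=
  integrable_kernel_mul hw ((hv.comp_fst σ).sub (hv.comp_snd σ)).integrable_sq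

lemma kernelDefect_le_add (hw : Continuous w) (hw0 : ∀ z, 0 ≤ w z)
    (hmass : ∀ p, ∫ q, w (p, q) ∂σ = 1)
    (hsymm : ∀ p q, w (p, q) = w (q, p)) {u v : X → ℝ} (hu : MemLp u 2 σ) (hv : MemLp v 2 σ) :
    kernelDefect σ w u ≤ 2 * kernelDefect σ w v + 4 * ∫ p, (u p - v p) ^ 2 ∂σ := by
  have hd : Integrable (fun p => (u p - v p) ^ 2) σ := (hu.sub hv).integrable_sq
  have e1 := integral_kernel_fst hw hmass hd
  have e2 := integral_kernel_snd hw hmass hsymm hd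
  have i1 := integrable_kernel_mul hw (hd.comp_fst σ)
  have i2 := integrable_kernel_mul hw (hd.comp_snd σ)
  have i12 : Integrable (fun z => w z * (u z.1 - v z.1) ^ 2 + w z * (u z.2 - v z.2) ^ 2)
      (σ.prod σ) := i1.add i2
  have i3 := integrable_kernel_sub_sq hw hv
  have key : ∫ z, w z * (u z.1 - u z.2) ^ 2 ∂(σ.prod σ) ≤
      ∫ z, (2 * (w z * (v z.1 - v z.2) ^ 2) + 4 * (w z * (u z.1 - v z.1) ^ 2
        + w z * (u z.2 - v z.2) ^ 2)) ∂(σ.prod σ) := by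
    refine integral_mono (integrable_kernel_sub_sq hw hu)
      ((i3.const_mul 2).add (i12.const_mul 4)) fun z => ?_
    have := mul_le_mul_of_nonneg_left (a := w z) (b := (u z.1 - u z.2) ^ 2)
      (c := 2 * (v z.1 - v z.2) ^ 2 + 4 * ((u z.1 - v z.1) ^ 2 + (u z.2 - v z.2) ^ 2))
      (by nlinarith [sq_nonneg ((u z.1 - v z.1) - (u z.2 - v z.2) - (v z.1 - v z.2)),
        sq_nonneg ((u z.1 - v z.1) + (u z.2 - v z.2))]) (hw0 z)
    simp only; linarith
  rw [integral_add (i3.const_mul 2) (i12.const_mul 4), integral_const_mul,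
    integral_const_mul, integral_add i1 i2, e1, e2] at key
  simp only [kernelDefect]
  linarith

/-- Averaging against symmetric, normalised, nonnegative continuous kernels which converge
pointwise to the identity on continuous functions converges to the identity as a quadratic form
on `L²`. -/
lemma tendsto_kernelDefect [T2Space X] {w : ℕ → X × X → ℝ} (hw : ∀ n, Continuous (w n))
    (hw0 : ∀ n z, 0 ≤ w n z) (hmass : ∀ n p, ∫ q, w n (p, q) ∂σ = 1)
    (hsymm : ∀ n p q, w n (p, q) = w n (q, p))
    (hlim : ∀ g : X → ℝ, Continuous g → ∀ p,
      Tendsto (fun n => ∫ q, w n (p, q) * g q ∂σ) atTop (𝓝 (g p)))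
    {u : X → ℝ} (hu : MemLp u 2 σ) :
    Tendsto (fun n => kernelDefect σ (w n) u) atTop (𝓝 0) := by
  have hcont : ∀ g : X → ℝ, Continuous g →
      Tendsto (fun n => kernelDefect σ (w n) g) atTop (𝓝 0) := by
    intro g hg
    obtain ⟨C, hC⟩ := (isCompact_range hg).isBounded.exists_norm_le
    have hC' : ∀ p, ‖g p‖ ≤ C := fun p => hC _ ⟨p, rfl⟩
    have hgL : MemLp g 2 σ := MemLp.of_bound hg.aestronglyMeasurable C (.of_forall hC')
    have hg1 : Integrable g σ := hgL.integrable (by norm_num)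
    have hi : ∀ n, ∫ z, w n z * (g z.1 * g z.2) ∂(σ.prod σ) =
        ∫ p, g p * ∫ q, w n (p, q) * g q ∂σ ∂σ := by
      intro n
      rw [integral_prod _ (integrable_kernel_mul (hw n) (hg1.mul_prod hg1))]
      refine integral_congr_ae (.of_forall fun p => ?_)
      simp only [← integral_const_mul]
      exact integral_congr_ae (.of_forall fun q => by ring_nf)
    have hconv : Tendsto (fun n => ∫ p, g p * ∫ q, w n (p, q) * g q ∂σ ∂σ) atTop
        (𝓝 (∫ p, g p * g p ∂σ)) := by
      refine tendsto_integral_of_dominated_convergence (fun _ => C * C) (fun n => ?_)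
        (integrable_const _) (fun n => .of_forall fun p => ?_)
        (.of_forall fun p => (hlim g hg p).const_mul _)
      · refine hg.aestronglyMeasurable.mul ?_
        exact (((hw n).mul (hg.comp continuous_snd)).aestronglyMeasurable
          (μ := σ.prod σ)).integral_prod_right'
      · rw [norm_mul]
        have hC0 : 0 ≤ C := (norm_nonneg _).trans (hC' p)
        refine mul_le_mul (hC' p) ?_ (norm_nonneg _) hC0
        have hwp : Continuous fun q => w n (p, q) := (hw n).comp (by fun_prop)
        calc ‖∫ q, w n (p, q) * g q ∂σ‖ ≤ ∫ q, w n (p, q) * C ∂σ := by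
              refine norm_integral_le_of_norm_le
                ((hwp.integrable_of_hasCompactSupport (.of_compactSpace _)).mul_const C)
                (.of_forall fun q => ?_)
              rw [norm_mul, Real.norm_of_nonneg (hw0 n _)]
              exact mul_le_mul_of_nonneg_left (hC' q) (hw0 n _)
          _ = C := by rw [integral_mul_const, hmass, one_mul]
    have : ∀ n, kernelDefect σ (w n) g
        = ∫ p, g p * g p ∂σ - ∫ p, g p * ∫ q, w n (p, q) * g q ∂σ ∂σ := by
      intro n
      have := integral_kernel_mul_mul (hw n) (hmass n) (hsymm n) hgL
      simp only [← hi n, this, pow_two]; ring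
    simp only [this]
    simpa using hconv.const_sub (∫ p, g p * g p ∂σ)
  rw [Metric.tendsto_atTop]
  intro ε hε
  obtain ⟨v, -, hv, hvc, hvL⟩ := (show MemLp u (ENNReal.ofReal 2) σ by
    simpa using hu).exists_hasCompactSupport_integral_rpow_sub_le
    (by norm_num : (0 : ℝ) < 2) (ε := ε / 16) (by positivity)
  obtain ⟨N, hN⟩ := Metric.tendsto_atTop.1 (hcont v hvc) (ε / 8) (by positivity)
  refine ⟨N, fun n hn => ?_⟩
  have h1 := hN n hn
  have h2 := kernelDefect_le_add (hw n) (hw0 n) (hmass n) (hsymm n) hu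
    (show MemLp v 2 σ by simpa using hvL)
  simp only [Real.dist_eq, sub_zero, Real.norm_eq_abs, Real.rpow_ofNat, sq_abs] at h1 hv ⊢
  rw [abs_of_nonneg (kernelDefect_nonneg (hw0 n) _)] at h1 ⊢
  linarith

end Kernel

end

/-! ### Zonal kernels as sums of squares -/

section

/-- The monomials `∏ l, e_{I l}(v)`, where `e_none = 1` and `e_{some i} = v_i`; they split the zonal
kernel `(1 + p · q) ^ n` into a sum of squares. -/
noncomputable def sphMono {d n : ℕ} (I : Fin n → Option (Fin d)) (v : Vec d) : ℝ :=
  ∏ l, (I l).elim 1 fun i => v i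

/-- The multinomial expansion of the zonal kernel, as a sum of products of monomials. -/
lemma sum_sphMono_mul {d n : ℕ} (v w : Vec d) :
    ∑ I : Fin n → Option (Fin d), sphMono I v * sphMono I w = (1 + inner ℝ v w) ^ n := by
  simp only [sphMono, ← Finset.prod_mul_distrib]
  rw [← Fintype.sum_pow (f := fun o : Option (Fin d) =>
    (o.elim 1 fun i => v i) * (o.elim 1 fun i => w i))]
  simp [Fintype.sum_option, PiLp.inner_apply, mul_comm]

lemma contDiff_sphMono {d n : ℕ} (I : Fin n → Option (Fin d)) : ContDiff ℝ ∞ (sphMono I) := by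
  unfold sphMono
  refine contDiff_prod fun l _ => ?_
  cases I l with
  | none => exact contDiff_const
  | some i => exact contDiff_piLp_apply (p := 2) (E := fun _ : Fin d => ℝ) (i := i)

lemma continuous_sphMono {d n : ℕ} (I : Fin n → Option (Fin d)) : Continuous (sphMono I) :=
  (contDiff_sphMono I).continuous

/-- A finite sum of products of integrals, as one double integral. -/
lemma sum_integral_mul_integral {ι X Y : Type*} [Fintype ι] [MeasurableSpace X]
    [MeasurableSpace Y] {σ : Measure X} {τ : Measure Y} [SFinite σ] [SFinite τ]
    {a : ι → X → ℝ} {b : ι → Y → ℝ} (ha : ∀ i, Integrable (a i) σ) (hb : ∀ i, Integrable (b i) τ) :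
    ∑ i, (∫ x, a i x ∂σ) * (∫ y, b i y ∂τ) = ∫ z, ∑ i, a i z.1 * b i z.2 ∂(σ.prod τ) := by
  rw [integral_finsetSum _ fun i _ => (ha i).mul_prod (hb i)]
  simp only [integral_prod_mul]

lemma integrable_mul_continuous {X : Type*} [TopologicalSpace X] [CompactSpace X]
    [SecondCountableTopology X] [MeasurableSpace X] [BorelSpace X] {σ : Measure X} {v g : X → ℝ}
    (hv : Integrable v σ) (hg : Continuous g) : Integrable (fun x => v x * g x) σ := by
  obtain ⟨C, hC⟩ := (isCompact_range hg).isBounded.exists_norm_le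
  exact hv.mul_bdd hg.aestronglyMeasurable (.of_forall fun z => hC _ ⟨z, rfl⟩)

/-- The zonal kernel normalised to have mass one in each variable. -/
noncomputable def zonalKernel {d : ℕ} (p₀ : Sph d) (n : ℕ) (z : Sph d × Sph d) : ℝ :=
  (zonalMass d n p₀)⁻¹ * (1 + inner ℝ (z.1 : Vec d) (z.2 : Vec d)) ^ n

section Zonal

variable {d : ℕ} (p₀ : Sph d)

lemma continuous_zonalKernel (n : ℕ) : Continuous (zonalKernel p₀ n) :=
  continuous_const.mul (continuous_zonal n)

lemma zonalKernel_nonneg (n : ℕ) (z : Sph d × Sph d) : 0 ≤ zonalKernel p₀ n z :=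
  mul_nonneg (inv_nonneg.2 (zonalMass_pos n p₀).le) (pow_nonneg (one_add_inner_nonneg _ _) n)

lemma integral_zonalKernel (n : ℕ) (p : Sph d) :
    ∫ q, zonalKernel p₀ n (p, q) ∂(sphMeasure d) = 1 := by
  simp only [zonalKernel]
  rw [integral_const_mul, ← zonalMass, zonalMass_eq n p p₀,
    inv_mul_cancel₀ (zonalMass_pos n p₀).ne']

lemma zonalKernel_symm (n : ℕ) (p q : Sph d) :
    zonalKernel p₀ n (p, q) = zonalKernel p₀ n (q, p) := by
  simp only [zonalKernel, real_inner_comm]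

lemma tendsto_zonalKernel {g : Sph d → ℝ} (hg : Continuous g) (p : Sph d) :
    Tendsto (fun n => ∫ q, zonalKernel p₀ n (p, q) * g q ∂(sphMeasure d)) atTop (𝓝 (g p)) := by
  refine (tendsto_zonal_average p hg).congr fun n => ?_
  rw [← integral_const_mul, zonalMass_eq n p p₀]
  exact integral_congr_ae (.of_forall fun q => by simp only [zonalKernel]; ring)

lemma inv_zonalMass_mul_sum_sq (n : ℕ) {v : Sph d → ℝ} (hv : MemLp v 2 (sphMeasure d)) :
    (zonalMass d n p₀)⁻¹ *
        ∑ I : Fin n → Option (Fin d), (∫ p, v p * sphMono I p ∂(sphMeasure d)) ^ 2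
      = ∫ p, v p ^ 2 ∂(sphMeasure d) - kernelDefect (sphMeasure d) (zonalKernel p₀ n) v := by
  have hv1 : Integrable v (sphMeasure d) := hv.integrable (by norm_num)
  have hi : ∀ I : Fin n → Option (Fin d),
      Integrable (fun p : Sph d => v p * sphMono I p) (sphMeasure d) := fun I =>
    integrable_mul_continuous hv1 ((continuous_sphMono I).comp continuous_subtype_val)
  rw [← integral_kernel_mul_mul (continuous_zonalKernel p₀ n) (integral_zonalKernel p₀ n)
    (zonalKernel_symm p₀ n) hv]
  simp only [pow_two]
  rw [sum_integral_mul_integral hi hi, ← integral_const_mul]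
  refine integral_congr_ae (.of_forall fun z => ?_)
  simp only [zonalKernel]
  rw [← sum_sphMono_mul, mul_assoc, Finset.sum_mul]
  congr 1
  exact Finset.sum_congr rfl fun I _ => by ring

lemma inv_zonalMass_mul_sum_sq_le (n : ℕ) {v : Sph d → ℝ} (hv : MemLp v 2 (sphMeasure d)) :
    (zonalMass d n p₀)⁻¹ *
        ∑ I : Fin n → Option (Fin d), (∫ p, v p * sphMono I p ∂(sphMeasure d)) ^ 2
      ≤ ∫ p, v p ^ 2 ∂(sphMeasure d) := by
  rw [inv_zonalMass_mul_sum_sq p₀ n hv]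
  linarith [kernelDefect_nonneg (σ := sphMeasure d) (zonalKernel_nonneg p₀ n) v]

/-- The normalised energies of the monomial moments exhaust the `L²` norm on the sphere. This
replaces the expansion in spherical harmonics. -/
lemma tendsto_inv_zonalMass_mul_sum_sq {v : Sph d → ℝ} (hv : MemLp v 2 (sphMeasure d)) :
    Tendsto (fun n => (zonalMass d n p₀)⁻¹ *
      ∑ I : Fin n → Option (Fin d), (∫ p, v p * sphMono I p ∂(sphMeasure d)) ^ 2) atTop
      (𝓝 (∫ p, v p ^ 2 ∂(sphMeasure d))) := by
  simp only [inv_zonalMass_mul_sum_sq p₀ _ hv]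
  simpa using (tendsto_kernelDefect (continuous_zonalKernel p₀) (zonalKernel_nonneg p₀)
    (integral_zonalKernel p₀) (zonalKernel_symm p₀)
    (fun g hg p => tendsto_zonalKernel p₀ hg p) hv).const_sub (∫ p, v p ^ 2 ∂(sphMeasure d))

/-- The zonal kernel concentrates on the diagonal; this is what makes the commutator of
averaging in `ω` with the transport `ω · ∇_x` vanish in the limit. -/
lemma tendsto_zonalKernel_norm_sub :
    Tendsto (fun n => ∫ z : Sph d × Sph d, zonalKernel p₀ n z * ‖(z.1 : Vec d) - z.2‖
      ∂((sphMeasure d).prod (sphMeasure d))) atTop (𝓝 0) := by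
  have hc : ∀ n, Continuous fun z : Sph d × Sph d => zonalKernel p₀ n z * ‖(z.1 : Vec d) - z.2‖ :=
    fun n => (continuous_zonalKernel p₀ n).mul (by fun_prop)
  have hcs : ∀ n p, Continuous fun q => zonalKernel p₀ n (p, q) := fun n p =>
    (continuous_zonalKernel p₀ n).comp (by fun_prop)
  have hi : ∀ n, ∫ z : Sph d × Sph d, zonalKernel p₀ n z * ‖(z.1 : Vec d) - z.2‖
      ∂((sphMeasure d).prod (sphMeasure d)) = ∫ p : Sph d, ∫ q : Sph d,
        zonalKernel p₀ n (p, q) * ‖(p : Vec d) - q‖ ∂(sphMeasure d) ∂(sphMeasure d) := fun n =>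
    integral_prod _ ((hc n).integrable_of_hasCompactSupport (.of_compactSpace _))
  simp only [hi]
  rw [← integral_zero (Sph d) ℝ (μ := sphMeasure d)]
  refine tendsto_integral_of_dominated_convergence (fun _ => 2) (fun n => ?_)
    (integrable_const _) (fun n => .of_forall fun p => ?_) (.of_forall fun p => ?_)
  · exact ((hc n).aestronglyMeasurable
      (μ := (sphMeasure d).prod (sphMeasure d))).integral_prod_right'
  · calc ‖∫ q : Sph d, zonalKernel p₀ n (p, q) * ‖(p : Vec d) - q‖ ∂(sphMeasure d)‖
        ≤ ∫ q : Sph d, zonalKernel p₀ n (p, q) * 2 ∂(sphMeasure d) := by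
          refine norm_integral_le_of_norm_le
            (((hcs n p).integrable_of_hasCompactSupport (.of_compactSpace _)).mul_const 2)
            (.of_forall fun q => ?_)
          rw [norm_mul, Real.norm_of_nonneg (zonalKernel_nonneg p₀ n _), norm_norm]
          refine mul_le_mul_of_nonneg_left ?_ (zonalKernel_nonneg p₀ n _)
          refine (norm_sub_le _ _).trans ?_
          simp; norm_num
      _ = 2 := by rw [integral_mul_const, integral_zonalKernel, one_mul]
  · simpa using tendsto_zonalKernel p₀ (g := fun q : Sph d => ‖(p : Vec d) - q‖) (by fun_prop) p

end Zonal

/-! ### Real Fourier series on the torus -/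

/-- The real trigonometric monomials on `𝕋^d`: `cos (2π k · x)` for `true` and `sin (2π k · x)` for
`false`. -/
noncomputable def trig {d : ℕ} (k : Fin d → ℤ) (b : Bool) (x : Torus d) : ℝ :=
  bif b then (UnitAddTorus.mFourier k x).re else (UnitAddTorus.mFourier k x).im

lemma continuous_trig {d : ℕ} (k : Fin d → ℤ) (b : Bool) : Continuous (trig k b) := by
  have := (UnitAddTorus.mFourier k).continuous
  cases b
  · exact Complex.continuous_im.comp this
  · exact Complex.continuous_re.comp this

lemma mFourier_toTorus {d : ℕ} (k : Fin d → ℤ) (v : Vec d) :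
    UnitAddTorus.mFourier k (toTorus v) =
      Complex.exp (((2 * Real.pi * ∑ i, k i * v i : ℝ) : ℂ) * Complex.I) := by
  simp only [UnitAddTorus.mFourier, toTorus, ContinuousMap.coe_mk, fourier_coe_apply]
  rw [← Complex.exp_sum]
  congr 1
  push_cast
  rw [Finset.mul_sum, Finset.sum_mul]
  exact Finset.sum_congr rfl fun i _ => by simp; ring

/-- The wave vector `2π k`. -/
noncomputable def waveVec {d : ℕ} (k : Fin d → ℤ) : Vec d :=
  WithLp.toLp 2 fun i => 2 * Real.pi * k i

lemma trig_toTorus {d : ℕ} (k : Fin d → ℤ) (b : Bool) (v : Vec d) :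
    trig k b (toTorus v) =
      bif b then Real.cos (inner ℝ (waveVec k) v) else Real.sin (inner ℝ (waveVec k) v) := by
  have : (inner ℝ (waveVec k) v : ℝ) = 2 * Real.pi * ∑ i, k i * v i := by
    simp only [waveVec, PiLp.inner_apply, Finset.mul_sum]
    exact Finset.sum_congr rfl fun i _ => by simp; ring
  rw [this, trig, mFourier_toTorus]
  cases b
  · simp only [cond_false, Complex.exp_ofReal_mul_I_im]
  · simp only [cond_true, Complex.exp_ofReal_mul_I_re]

lemma toTorus_surjective {d : ℕ} (x : Torus d) : ∃ v : Vec d, toTorus v = x := by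
  choose v hv using fun i => QuotientAddGroup.mk_surjective (x i)
  exact ⟨WithLp.toLp 2 v, funext hv⟩

lemma volume_torus (d : ℕ) :
    (volume : Measure (Torus d)) = Measure.pi fun _ => AddCircle.haarAddCircle := by
  rw [volume_pi]
  congr 1
  funext i
  rw [AddCircle.volume_eq_smul_haarAddCircle]
  simp

/-- Parseval's identity on the torus, for real functions and real trigonometric monomials. -/
lemma hasSum_trig_sq {d : ℕ} {v : Torus d → ℝ} (hv : MemLp v 2 volume) :
    HasSum (fun k : Fin d → ℤ => ∑ b, (∫ x, v x * trig k b x) ^ 2) (∫ x, v x ^ 2) := by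
  rw [volume_torus] at hv ⊢
  have hvc : MemLp (fun x => (v x : ℂ)) 2 (Measure.pi fun _ : Fin d => AddCircle.haarAddCircle) :=
    hv.ofReal
  have h := UnitAddTorus.hasSum_sq_mFourierCoeff (d := Fin d) (hvc.toLp _)
  set π : Measure (Torus d) := Measure.pi fun _ : Fin d => AddCircle.haarAddCircle
  have hco : (hvc.toLp _ : Torus d → ℂ) =ᵐ[π] fun x => (v x : ℂ) := hvc.coeFn_toLp
  have hcoeff : ∀ k : Fin d → ℤ, ‖UnitAddTorus.mFourierCoeff (hvc.toLp _ : Torus d → ℂ) k‖ ^ 2 =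
      ∑ b, (∫ x, v x * trig k b x ∂π) ^ 2 := by
    intro k
    have hint : Integrable (fun x => UnitAddTorus.mFourier (-k) x * (v x : ℂ)) π := by
      refine (hvc.integrable (by norm_num)).bdd_mul (c := 1)
        (UnitAddTorus.mFourier (-k)).continuous.aestronglyMeasurable (.of_forall fun x => ?_)
      exact ((UnitAddTorus.mFourier (-k)).norm_coe_le_norm x).trans_eq UnitAddTorus.mFourier_norm
    have e : UnitAddTorus.mFourierCoeff (hvc.toLp _ : Torus d → ℂ) k =
        ∫ x, UnitAddTorus.mFourier (-k) x * (v x : ℂ) ∂π := by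
      refine integral_congr_ae ?_
      filter_upwards [hco] with x hx
      rw [hx, smul_eq_mul]
    have hre := Complex.reCLM.integral_comp_comm hint
    have him := Complex.imCLM.integral_comp_comm hint
    rw [e, Complex.sq_norm, Complex.normSq_apply, ← pow_two, ← pow_two, Fintype.sum_bool]
    simp only [Complex.reCLM_apply, Complex.imCLM_apply] at hre him
    rw [← hre, ← him]
    congr 1
    · congr 1
      refine integral_congr_ae (.of_forall fun x => ?_)
      simp [UnitAddTorus.mFourier_neg, trig, mul_comm]
    · rw [← neg_sq, ← integral_neg]
      congr 1
      refine integral_congr_ae (.of_forall fun x => ?_)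
      simp [UnitAddTorus.mFourier_neg, trig, mul_comm]
  have hnorm : ∫ x, ‖(hvc.toLp _ : Torus d → ℂ) x‖ ^ 2 ∂π = ∫ x, v x ^ 2 ∂π := by
    refine integral_congr_ae ?_
    filter_upwards [hco] with x hx
    rw [hx]
    simp
  rw [← hnorm]
  simp only [← hcoeff]
  exact h

end

/-! ### Weak differential equations in time -/

section

/-- The time profiles `χ ∈ C^∞` of test functions on `[0,T)`: they vanish near `T`. -/
def IsTimeTest (T : ℝ) (χ : ℝ → ℝ) : Prop :=
  ContDiff ℝ ∞ χ ∧ ∃ T' < T, ∀ t, T' ≤ t → χ t = 0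

lemma exists_lt_forall_eq_zero {T : ℝ} {g : ℝ → ℝ} (hs : tsupport g ⊆ Set.Ioo 0 T) :
    ∃ T' < T, ∀ t, T' ≤ t → g t = 0 := by
  have hT : (tsupport g)ᶜ ∈ 𝓝 T :=
    (isClosed_tsupport g).isOpen_compl.mem_nhds fun h => lt_irrefl _ (hs h).2
  obtain ⟨l, hl, hlT⟩ := exists_Ioc_subset_of_mem_nhds hT ⟨T - 1, by linarith⟩
  refine ⟨(l + T) / 2, by linarith, fun t ht => ?_⟩
  by_contra h0
  have ht' : t ∈ tsupport g := subset_tsupport g h0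
  exact hlT ⟨by linarith, (hs ht').2.le⟩ ht'

lemma ae_eq_zero_of_forall_timeTest {T : ℝ} {a : ℝ → ℝ} (ha : IntegrableOn a (Set.Ioo 0 T))
    (h : ∀ χ, IsTimeTest T χ → ∫ t in Set.Ioo 0 T, χ t * a t = 0) :
    ∀ᵐ t ∂(volume.restrict (Set.Ioo 0 T)), a t = 0 := by
  rw [ae_restrict_iff' measurableSet_Ioo]
  refine isOpen_Ioo.ae_eq_zero_of_integral_contDiff_smul_eq_zero ha.locallyIntegrableOn
    fun g hg _ hs => ?_
  rw [← h g ⟨hg, exists_lt_forall_eq_zero hs⟩]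
  refine (setIntegral_eq_integral_of_forall_compl_eq_zero fun t ht => ?_).symm
  rw [image_eq_zero_of_notMem_tsupport fun h' => ht (hs h'), zero_smul]

/-- The weak form of `a' = b`, `a(0) = 0` determines `a` almost everywhere. -/
lemma ae_eq_integral_of_forall_timeTest {T : ℝ} (hT : 0 < T) {a b : ℝ → ℝ}
    (ha : IntegrableOn a (Set.Ioo 0 T)) (hb : IntegrableOn b (Set.Ioo 0 T))
    (h : ∀ χ, IsTimeTest T χ → ∫ t in Set.Ioo 0 T, (deriv χ t * a t + χ t * b t) = 0) :
    ∀ᵐ t ∂(volume.restrict (Set.Ioo 0 T)), a t = ∫ s in 0..t, b s := by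
  have hbi : IntervalIntegrable b volume 0 T := by
    rwa [intervalIntegrable_iff_integrableOn_Ioo_of_le hT.le]
  have hY := hbi.absolutelyContinuousOnInterval_intervalIntegral (c := 0) (by simp)
  set Y : ℝ → ℝ := fun t => ∫ s in 0..t, b s with hYdef
  have hYc : ContinuousOn Y (Set.Icc 0 T) := by simpa [Set.uIcc_of_le hT.le] using hY.continuousOn
  have hYi : IntegrableOn Y (Set.Ioo 0 T) :=
    (hYc.integrableOn_compact isCompact_Icc).mono_set Set.Ioo_subset_Icc_self
  suffices H : ∀ᵐ t ∂(volume.restrict (Set.Ioo 0 T)), a t - Y t = 0 by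
    filter_upwards [H] with t ht using sub_eq_zero.1 ht
  rw [ae_restrict_iff' measurableSet_Ioo]
  refine isOpen_Ioo.ae_eq_zero_of_integral_contDiff_smul_eq_zero
    (ha.sub hYi).locallyIntegrableOn fun ψ hψ _ hs => ?_
  obtain ⟨T', hT', hψ0⟩ := exists_lt_forall_eq_zero hs
  -- the primitive of `ψ` that vanishes at `T` is admissible, with no condition at `t = 0`
  set χ : ℝ → ℝ := fun t => ∫ s in T..t, ψ s with hχdef
  have hder : ∀ t, HasDerivAt χ (ψ t) t := fun t =>
    intervalIntegral.integral_hasDerivAt_right (hψ.continuous.intervalIntegrable _ _)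
      (hψ.continuous.stronglyMeasurableAtFilter _ _) hψ.continuous.continuousAt
  have hderiv : deriv χ = ψ := funext fun t => (hder t).deriv
  have hχs : ContDiff ℝ ∞ χ := by
    rw [contDiff_infty_iff_deriv, hderiv]
    exact ⟨fun t => (hder t).differentiableAt, hψ⟩
  have hχ0 : ∀ t, T' ≤ t → χ t = 0 := fun t ht => by
    refine (intervalIntegral.integral_congr fun s hs' => ?_).trans
      (intervalIntegral.integral_zero (E := ℝ) (a := T) (b := t))
    exact hψ0 s ((le_min hT'.le ht).trans hs'.1)
  have hχ := h χ ⟨hχs, T', hT', hχ0⟩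
  have hχac : AbsolutelyContinuousOnInterval χ 0 T :=
    (hχs.of_le (by simp)).contDiffOn.absolutelyContinuousOnInterval
  have hparts := hχac.integral_mul_deriv_eq_deriv_mul hY
  rw [hχ0 T hT'.le, hderiv] at hparts
  have hY0 : Y 0 = 0 := by simp [hYdef]
  rw [hY0] at hparts
  have hYd : ∫ t in 0..T, χ t * deriv Y t = ∫ t in 0..T, χ t * b t := by
    refine intervalIntegral.integral_congr_ae ?_
    filter_upwards [hbi.ae_hasDerivAt_integral] with t ht htm
    rw [(ht (Set.uIoc_subset_uIcc htm) 0 (by simp)).deriv]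
  rw [hYd, intervalIntegral.integral_of_le hT.le, intervalIntegral.integral_of_le hT.le,
    integral_Ioc_eq_integral_Ioo, integral_Ioc_eq_integral_Ioo] at hparts
  have hψb : ∃ C, ∀ t ∈ Set.Icc 0 T, ‖ψ t‖ ≤ C := isCompact_Icc.exists_bound_of_continuousOn
    hψ.continuous.continuousOn
  have hχb : ∃ C, ∀ t ∈ Set.Icc 0 T, ‖χ t‖ ≤ C := isCompact_Icc.exists_bound_of_continuousOn
    hχs.continuous.continuousOn
  obtain ⟨C, hC⟩ := hψb
  obtain ⟨C', hC'⟩ := hχb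
  have hm : ∀ {f : ℝ → ℝ} {C : ℝ}, (∀ t ∈ Set.Icc 0 T, ‖f t‖ ≤ C) →
      ∀ᵐ t ∂(volume.restrict (Set.Ioo 0 T)), ‖f t‖ ≤ C := fun hf => by
    filter_upwards [ae_restrict_mem measurableSet_Ioo] with t ht
    exact hf t (Set.Ioo_subset_Icc_self ht)
  have i1 : IntegrableOn (fun t => ψ t * a t) (Set.Ioo 0 T) :=
    ha.bdd_mul hψ.continuous.aestronglyMeasurable (hm hC)
  have i2 : IntegrableOn (fun t => χ t * b t) (Set.Ioo 0 T) :=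
    hb.bdd_mul hχs.continuous.aestronglyMeasurable (hm hC')
  have i3 : IntegrableOn (fun t => ψ t * Y t) (Set.Ioo 0 T) :=
    hYi.bdd_mul hψ.continuous.aestronglyMeasurable (hm hC)
  rw [hderiv, integral_add i1 i2] at hχ
  rw [← setIntegral_eq_integral_of_forall_compl_eq_zero (s := Set.Ioo 0 T)]
  · simp only [smul_eq_mul, mul_sub]
    rw [integral_sub i1 i3]
    linarith
  · intro t ht
    rw [image_eq_zero_of_notMem_tsupport fun h' => ht (hs h'), zero_smul]

/-- The chain rule for the square of an absolutely continuous primitive. -/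
lemma sq_integral_eq {T t : ℝ} {b : ℝ → ℝ} (hb : IntegrableOn b (Set.Ioo 0 T))
    (ht : t ∈ Set.Ioo 0 T) :
    (∫ s in 0..t, b s) ^ 2 = 2 * ∫ s in Set.Ioo 0 t, (∫ r in 0..s, b r) * b s := by
  have hbi : IntervalIntegrable b volume 0 t := by
    rw [intervalIntegrable_iff_integrableOn_Ioo_of_le ht.1.le]
    exact hb.mono_set (Set.Ioo_subset_Ioo_right ht.2.le)
  have hY := hbi.absolutelyContinuousOnInterval_intervalIntegral (c := 0) (by simp)
  have h := hY.integral_mul_deriv_eq_deriv_mul hY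
  have e : ∀ F : ℝ → ℝ → ℝ, ∫ s in 0..t, F s (deriv (fun x => ∫ r in 0..x, b r) s)
      = ∫ s in 0..t, F s (b s) := fun F => by
    refine intervalIntegral.integral_congr_ae ?_
    filter_upwards [hbi.ae_hasDerivAt_integral] with s hs hsm
    rw [(hs (Set.uIoc_subset_uIcc hsm) 0 (by simp)).deriv]
  rw [e fun s x => (∫ r in 0..s, b r) * x, e fun s x => x * (∫ r in 0..s, b r)] at h
  simp only [intervalIntegral.integral_same, mul_comm (b _)] at h
  rw [intervalIntegral.integral_of_le ht.1.le (f := fun s => (∫ r in 0..s, b r) * b s),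
    integral_Ioc_eq_integral_Ioo] at h
  rw [pow_two]
  linarith

end

/-! ### Test functions built from trigonometric and spherical monomials -/

section

variable {d : ℕ}

/-- The derivative of `trig k b` along a unit of phase. -/
noncomputable def trigDeriv (k : Fin d → ℤ) (b : Bool) (x : Torus d) : ℝ :=
  bif b then -trig k false x else trig k true x

lemma continuous_trigDeriv (k : Fin d → ℤ) (b : Bool) : Continuous (trigDeriv k b) := by
  cases b
  · exact continuous_trig k true
  · exact (continuous_trig k false).neg

/-- The stationary part `trig(x) · monomial(ω)` of the test functions. -/
noncomputable def mode {n : ℕ} (k : Fin d → ℤ) (b : Bool) (I : Fin n → Option (Fin d))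
    (p : Phase d) : ℝ :=
  trig k b p.1 * sphMono I p.2

/-- The transport derivative `ω · ∇_x` of `mode k b I`. -/
noncomputable def modeTransport {n : ℕ} (k : Fin d → ℤ) (b : Bool) (I : Fin n → Option (Fin d))
    (p : Phase d) : ℝ :=
  inner ℝ (waveVec k) (p.2 : Vec d) * trigDeriv k b p.1 * sphMono I p.2

/-- The spherical gradient of `mode k b I`. -/
noncomputable def modeGrad {n : ℕ} (k : Fin d → ℤ) (b : Bool) (I : Fin n → Option (Fin d))
    (p : Phase d) : Vec d :=
  trig k b p.1 • proj p.2 (gradient (sphMono I) p.2)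

lemma continuous_gradient_sphMono {n : ℕ} (I : Fin n → Option (Fin d)) :
    Continuous (gradient (sphMono I)) :=
  (LinearIsometryEquiv.continuous _).comp ((contDiff_sphMono I).continuous_fderiv (by simp))

lemma continuous_mode {n : ℕ} (k : Fin d → ℤ) (b : Bool) (I : Fin n → Option (Fin d)) :
    Continuous (mode k b I) :=
  ((continuous_trig k b).comp continuous_fst).mul
    ((continuous_sphMono I).comp (continuous_subtype_val.comp continuous_snd))

lemma continuous_modeTransport {n : ℕ} (k : Fin d → ℤ) (b : Bool) (I : Fin n → Option (Fin d)) :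
    Continuous (modeTransport k b I) :=
  (Continuous.mul (by fun_prop) ((continuous_trigDeriv k b).comp continuous_fst)).mul
    ((continuous_sphMono I).comp (continuous_subtype_val.comp continuous_snd))

lemma continuous_modeGrad {n : ℕ} (k : Fin d → ℤ) (b : Bool) (I : Fin n → Option (Fin d)) :
    Continuous (modeGrad k b I) := by
  have h1 : Continuous fun p : Phase d => trig k b p.1 := (continuous_trig k b).comp continuous_fst
  have h2 : Continuous fun p : Phase d => gradient (sphMono I) (p.2 : Vec d) :=
    (continuous_gradient_sphMono I).comp (continuous_subtype_val.comp continuous_snd)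
  unfold modeGrad proj
  fun_prop

lemma hasDerivAt_trig_toTorus (k : Fin d → ℤ) (b : Bool) (x : Torus d) (w : Vec d) :
    HasDerivAt (fun s : ℝ => trig k b (x + toTorus (s • w)))
      (inner ℝ (waveVec k) w * trigDeriv k b x) 0 := by
  obtain ⟨v, rfl⟩ := toTorus_surjective x
  have hadd : ∀ s : ℝ, toTorus v + toTorus (s • w) = toTorus (v + s • w) := fun s => by
    funext i; simp [toTorus]
  have hph : HasDerivAt (fun s : ℝ => (inner ℝ (waveVec k) (v + s • w) : ℝ))
      (inner ℝ (waveVec k) w) 0 := by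
    simp only [inner_add_right, inner_smul_right]
    simpa using ((hasDerivAt_id (0 : ℝ)).mul_const (inner ℝ (waveVec k) w)).const_add
      (inner ℝ (waveVec k) v)
  simp only [hadd, trigDeriv, trig_toTorus]
  cases b
  · simpa [mul_comm] using hph.sin
  · simpa [mul_comm] using hph.cos

variable {n : ℕ} {T : ℝ} {χ : ℝ → ℝ}

lemma isTestFunction_mul (hχ : IsTimeTest T χ) (k : Fin d → ℤ) (b : Bool)
    (I : Fin n → Option (Fin d)) :
    IsTestFunction T fun t x w => χ t * (trig k b x * sphMono I w) := by
  refine ⟨?_, ?_⟩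
  · simp only [trig_toTorus]
    refine (hχ.1.comp contDiff_fst).mul (ContDiff.mul ?_
      ((contDiff_sphMono I).comp (contDiff_snd.comp contDiff_snd)))
    have : ContDiff ℝ ∞ fun p : ℝ × Vec d × Vec d => (inner ℝ (waveVec k) p.2.1 : ℝ) :=
      contDiff_const.inner ℝ (contDiff_fst.comp contDiff_snd)
    cases b
    · exact this.sin
    · exact this.cos
  · obtain ⟨T', hT', h⟩ := hχ.2
    exact ⟨T', hT', fun t ht x w => by simp [h t ht]⟩

lemma timeDeriv_mul (k : Fin d → ℤ) (b : Bool) (I : Fin n → Option (Fin d)) (t : ℝ)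
    (p : Phase d) :
    timeDeriv (fun t x w => χ t * (trig k b x * sphMono I w)) t p = deriv χ t * mode k b I p :=
  deriv_mul_const_field _

lemma transportDeriv_mul (k : Fin d → ℤ) (b : Bool) (I : Fin n → Option (Fin d)) (t : ℝ)
    (p : Phase d) :
    transportDeriv (fun t x w => χ t * (trig k b x * sphMono I w)) t p
      = χ t * modeTransport k b I p :=
  (((hasDerivAt_trig_toTorus k b p.1 p.2).mul_const (sphMono I p.2)).const_mul (χ t)).deriv

lemma proj_smul (w v : Vec d) (c : ℝ) : proj w (c • v) = c • proj w v := by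
  simp only [proj, inner_smul_right, smul_sub, smul_smul]

lemma hasGradientAt_sphMono (I : Fin n → Option (Fin d)) (w : Vec d) :
    HasGradientAt (sphMono I) (gradient (sphMono I) w) w :=
  ((contDiff_sphMono I).differentiable (by simp) w).hasGradientAt

lemma sphereGrad_mul (k : Fin d → ℤ) (b : Bool) (I : Fin n → Option (Fin d)) (t : ℝ)
    (p : Phase d) :
    sphereGrad (fun t x w => χ t * (trig k b x * sphMono I w)) t p = χ t • modeGrad k b I p := by
  have h : HasGradientAt (fun w : Vec d => χ t * (trig k b p.1 * sphMono I w))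
      ((χ t * trig k b p.1) • gradient (sphMono I) p.2) p.2 := by
    have := (hasGradientAt_sphMono I (p.2 : Vec d)).hasFDerivAt.const_mul (χ t * trig k b p.1)
    rw [hasGradientAt_iff_hasFDerivAt, map_smul]
    simpa only [mul_assoc] using this
  rw [sphereGrad, h.gradient, proj_smul, modeGrad, smul_smul]

/-! ### Rotation fields -/

/-- The rotation field `w_i ∂_j - w_j ∂_i` applied to a monomial. -/
noncomputable def sphRot (i j : Fin d) (I : Fin n → Option (Fin d)) (w : Vec d) : ℝ :=
  w i * gradient (sphMono I) w j - w j * gradient (sphMono I) w i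

lemma continuous_sphRot (i j : Fin d) (I : Fin n → Option (Fin d)) : Continuous (sphRot i j I) := by
  have h := continuous_gradient_sphMono I
  have hc : ∀ l : Fin d, Continuous fun w : Vec d => gradient (sphMono I) w l := fun l => by
    fun_prop
  exact (Continuous.mul (by fun_prop) (hc j)).sub (Continuous.mul (by fun_prop) (hc i))

/-- The gradient of the zonal kernel in its second variable. -/
lemma sum_sphMono_mul_gradient (v w : Vec d) (j : Fin d) :
    ∑ I : Fin n → Option (Fin d), sphMono I v * gradient (sphMono I) w j
      = n * (1 + inner ℝ v w) ^ (n - 1) * v j := by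
  set y : Vec d := EuclideanSpace.single j 1
  have h1 : HasFDerivAt (fun w : Vec d => ∑ I : Fin n → Option (Fin d), sphMono I v * sphMono I w)
      (∑ I : Fin n → Option (Fin d), sphMono I v • fderiv ℝ (sphMono I) w) w :=
    HasFDerivAt.fun_sum fun I _ =>
      (((contDiff_sphMono I).differentiable (by simp) w).hasFDerivAt).const_mul _
  have h2 : HasFDerivAt (fun w : Vec d => (1 + inner ℝ v w) ^ n)
      ((n • (1 + inner ℝ v w) ^ (n - 1)) • innerSL ℝ v) w :=
    (((innerSL ℝ v).hasFDerivAt (x := w)).const_add 1).pow n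
  simp only [sum_sphMono_mul] at h1
  have h := congrArg (fun L : Vec d →L[ℝ] ℝ => L y) (h1.unique h2)
  have hy : ∀ z : Vec d, (inner ℝ z y : ℝ) = z j := fun z => by
    simp [y, EuclideanSpace.inner_single_right]
  simp only [sum_apply, smul_apply, ← inner_gradient_left,
    innerSL_apply_apply, hy, smul_eq_mul, nsmul_eq_mul] at h
  exact h

/-- The zonal kernel is invariant under simultaneous rotation of both variables. -/
lemma sum_sphMono_mul_sphRot (i j : Fin d) (v w : Vec d) :
    ∑ I : Fin n → Option (Fin d), sphMono I v * sphRot i j I w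
      = -∑ I : Fin n → Option (Fin d), sphRot i j I v * sphMono I w := by
  have h : ∀ v w : Vec d, ∑ I : Fin n → Option (Fin d), sphMono I v * sphRot i j I w
      = n * (1 + inner ℝ v w) ^ (n - 1) * (w i * v j - w j * v i) := fun v w => by
    have hi := sum_sphMono_mul_gradient (n := n) v w i
    have hj := sum_sphMono_mul_gradient (n := n) v w j
    calc _ = w i * ∑ I : Fin n → Option (Fin d), sphMono I v * gradient (sphMono I) w j
          - w j * ∑ I : Fin n → Option (Fin d), sphMono I v * gradient (sphMono I) w i := by
          rw [Finset.mul_sum, Finset.mul_sum, ← Finset.sum_sub_distrib]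
          exact Finset.sum_congr rfl fun I _ => by rw [sphRot]; ring
      _ = _ := by rw [hi, hj]; ring
  simp only [mul_comm (sphRot i j _ v)]
  rw [h, h, real_inner_comm]
  ring

/-- The rotational component `ω_i V_j - ω_j V_i` of a vector `V` at `ω`. -/
def rotComp (i j : Fin d) (w V : Vec d) : ℝ := w i * V j - w j * V i

lemma sum_rotComp_mul (w V g : Vec d) :
    ∑ i, ∑ j, rotComp i j w V * rotComp i j w g
      = 2 * (inner ℝ w w * inner ℝ V g - inner ℝ w V * inner ℝ w g) := by
  have hin : ∀ a b : Vec d, (inner ℝ a b : ℝ) = ∑ i, a i * b i := fun a b => by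
    simp [PiLp.inner_apply, mul_comm]
  have split : ∀ a b c e : Fin d → ℝ, (∑ i, a i * b i) * (∑ j, c j * e j)
      = ∑ i, ∑ j, a i * b i * (c j * e j) := fun a b c e => Finset.sum_mul_sum ..
  have h : 2 * (inner ℝ w w * inner ℝ V g - inner ℝ w V * inner ℝ w g)
      = ((∑ i, w i * w i) * (∑ j, V j * g j) + (∑ i, V i * g i) * (∑ j, w j * w j))
        - ((∑ i, w i * V i) * (∑ j, w j * g j) + (∑ i, w i * g i) * (∑ j, w j * V j)) := by
    rw [hin, hin, hin, hin]; ring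
  rw [h, split, split, split, split]
  simp only [← Finset.sum_add_distrib, ← Finset.sum_sub_distrib]
  exact Finset.sum_congr rfl fun i _ => Finset.sum_congr rfl fun j _ => by
    simp only [rotComp]; ring

lemma inner_self_sph (p : Sph d) : (inner ℝ (p : Vec d) (p : Vec d) : ℝ) = 1 := by
  simp

/-- The rotation fields form a frame of the tangent space: they recover the tangential inner
product. -/
lemma inner_proj_eq_sum_rotComp (p : Sph d) (V g : Vec d) :
    inner ℝ V (proj p g) = 2⁻¹ * ∑ i, ∑ j, rotComp i j p V * rotComp i j p g := by
  rw [sum_rotComp_mul, inner_self_sph, proj, inner_sub_right, inner_smul_right, real_inner_comm V]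
  ring

lemma sum_rotComp_sq_le (p : Sph d) (V : Vec d) :
    ∑ i, ∑ j, rotComp i j p V ^ 2 ≤ 2 * ‖V‖ ^ 2 := by
  simp only [pow_two]
  rw [sum_rotComp_mul, inner_self_sph, real_inner_self_eq_norm_mul_norm]
  nlinarith [mul_self_nonneg (inner ℝ (p : Vec d) V)]

lemma abs_rotComp_le (i j : Fin d) (p : Sph d) (V : Vec d) : |rotComp i j p V| ≤ 2 * ‖V‖ := by
  have hp : ∀ l : Fin d, |(p : Vec d) l| ≤ 1 := fun l => by
    simpa using PiLp.norm_apply_le (p : Vec d) l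
  have hV : ∀ l : Fin d, |V l| ≤ ‖V‖ := fun l => by simpa using PiLp.norm_apply_le V l
  have h : ∀ a b : Fin d, |(p : Vec d) a * V b| ≤ ‖V‖ := fun a b => by
    rw [abs_mul]
    nlinarith [hp a, hV b, abs_nonneg (V b), abs_nonneg ((p : Vec d) a), norm_nonneg V]
  refine (abs_sub _ _).trans ?_
  linarith [h i j, h j i]

lemma inner_modeGrad (k : Fin d → ℤ) (b : Bool) (I : Fin n → Option (Fin d)) (p : Phase d)
    (V : Vec d) :
    inner ℝ V (modeGrad k b I p)
      = 2⁻¹ * ∑ i, ∑ j, rotComp i j p.2 V * (trig k b p.1 * sphRot i j I p.2) := by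
  rw [modeGrad, inner_smul_right, inner_proj_eq_sum_rotComp]
  simp only [Finset.mul_sum]
  exact Finset.sum_congr rfl fun i _ => Finset.sum_congr rfl fun j _ => by
    simp only [sphRot, rotComp]; ring

end

/-! ### The linear equation and its modes -/

section

variable {d : ℕ}

instance (d : ℕ) : IsFiniteMeasure (phaseMeasure d) := by unfold phaseMeasure; infer_instance

instance (d : ℕ) (T : ℝ) : IsFiniteMeasure (spaceTimeMeasure d T) := by
  unfold spaceTimeMeasure; infer_instance

variable {T : ℝ} {n : ℕ}

lemma exists_bound_Ioo {χ : ℝ → ℝ} (hχ : Continuous χ) (T : ℝ) :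
    ∃ C, ∀ t ∈ Set.Ioo 0 T, ‖χ t‖ ≤ C :=
  (isCompact_Icc.exists_bound_of_continuousOn hχ.continuousOn).imp fun _ hC t ht =>
    hC t (Set.Ioo_subset_Icc_self ht)

lemma ae_spaceTime_mem (d : ℕ) (T : ℝ) :
    ∀ᵐ q ∂(spaceTimeMeasure d T), q.1 ∈ Set.Ioo 0 T :=
  Measure.quasiMeasurePreserving_fst.ae (ae_restrict_mem measurableSet_Ioo)

lemma integrable_time_mul {χ : ℝ → ℝ} (hχ : Continuous χ) {A : ℝ × Phase d → ℝ}
    (hA : Integrable A (spaceTimeMeasure d T)) :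
    Integrable (fun q => χ q.1 * A q) (spaceTimeMeasure d T) := by
  obtain ⟨C, hC⟩ := exists_bound_Ioo hχ T
  refine hA.bdd_mul (c := C) (hχ.comp continuous_fst).aestronglyMeasurable ?_
  filter_upwards [ae_spaceTime_mem d T] with q hq using hC _ hq

lemma integral_time_mul {χ : ℝ → ℝ} (hχ : Continuous χ) {A : ℝ × Phase d → ℝ}
    (hA : Integrable A (spaceTimeMeasure d T)) :
    ∫ q, χ q.1 * A q ∂(spaceTimeMeasure d T)
      = ∫ t in Set.Ioo 0 T, χ t * ∫ p, A (t, p) ∂(phaseMeasure d) := by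
  rw [spaceTimeMeasure, integral_prod _ (integrable_time_mul hχ hA)]
  simp only [integral_const_mul]

lemma ae_integral_slice_eq_zero {A : ℝ × Phase d → ℝ} (hA : Integrable A (spaceTimeMeasure d T))
    (h : ∀ χ, IsTimeTest T χ → ∫ q, χ q.1 * A q ∂(spaceTimeMeasure d T) = 0) :
    ∀ᵐ t ∂(volume.restrict (Set.Ioo 0 T)), ∫ p, A (t, p) ∂(phaseMeasure d) = 0 :=
  ae_eq_zero_of_forall_timeTest (Integrable.integral_prod_left hA) fun χ hχ => by
    rw [← integral_time_mul hχ.1.continuous hA, h χ hχ]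

lemma ae_integral_slice_eq (hT : 0 < T) {A B : ℝ × Phase d → ℝ}
    (hA : Integrable A (spaceTimeMeasure d T)) (hB : Integrable B (spaceTimeMeasure d T))
    (h : ∀ χ, IsTimeTest T χ →
      ∫ q, (deriv χ q.1 * A q + χ q.1 * B q) ∂(spaceTimeMeasure d T) = 0) :
    ∀ᵐ t ∂(volume.restrict (Set.Ioo 0 T)), ∫ p, A (t, p) ∂(phaseMeasure d)
      = ∫ s in 0..t, ∫ p, B (s, p) ∂(phaseMeasure d) := by
  have hA' := Integrable.integral_prod_left hA
  have hB' := Integrable.integral_prod_left hB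
  refine ae_eq_integral_of_forall_timeTest hT hA' hB' fun χ hχ => ?_
  have hχ' : Continuous (deriv χ) := hχ.1.continuous_deriv (by simp)
  have hm : ∀ {f : ℝ → ℝ}, Continuous f → ∀ {F : ℝ → ℝ}, IntegrableOn F (Set.Ioo 0 T) →
      IntegrableOn (fun t => f t * F t) (Set.Ioo 0 T) := fun {f} hf {F} hF => by
    obtain ⟨C, hC⟩ := exists_bound_Ioo hf T
    refine Integrable.bdd_mul (c := C) hF hf.aestronglyMeasurable ?_
    filter_upwards [ae_restrict_mem measurableSet_Ioo] with t ht using hC t ht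
  rw [integral_add (hm hχ' hA') (hm hχ.1.continuous hB'), ← integral_time_mul hχ' hA,
    ← integral_time_mul hχ.1.continuous hB, ← integral_add (integrable_time_mul hχ' hA)
    (integrable_time_mul hχ.1.continuous hB)]
  exact h χ hχ

lemma exists_bound_of_continuous {X E : Type*} [TopologicalSpace X] [CompactSpace X]
    [SeminormedAddCommGroup E] {c : X → E} (hc : Continuous c) : ∃ C, ∀ x, ‖c x‖ ≤ C := by
  obtain ⟨C, hC⟩ := (isCompact_range hc).isBounded.exists_norm_le
  exact ⟨C, fun x => hC _ ⟨x, rfl⟩⟩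

lemma integrable_mul_snd {A : ℝ × Phase d → ℝ} (hA : Integrable A (spaceTimeMeasure d T))
    {c : Phase d → ℝ} (hc : Continuous c) :
    Integrable (fun q => A q * c q.2) (spaceTimeMeasure d T) := by
  obtain ⟨C, hC⟩ := exists_bound_of_continuous hc
  exact hA.mul_bdd (hc.comp continuous_snd).aestronglyMeasurable (.of_forall fun q => hC _)

lemma integrable_inner_snd {A : ℝ × Phase d → Vec d} (hA : Integrable A (spaceTimeMeasure d T))
    {c : Phase d → Vec d} (hc : Continuous c) :
    Integrable (fun q => (inner ℝ (A q) (c q.2) : ℝ)) (spaceTimeMeasure d T) := by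
  obtain ⟨C, hC⟩ := exists_bound_of_continuous hc
  refine (hA.norm.mul_const C).mono' (hA.aestronglyMeasurable.inner
    (hc.comp continuous_snd).aestronglyMeasurable) (.of_forall fun q => ?_)
  exact (norm_inner_le_norm _ _).trans (mul_le_mul_of_nonneg_left (hC _) (norm_nonneg _))

lemma integrable_time_smul {χ : ℝ → ℝ} (hχ : Continuous χ) {A : ℝ × Phase d → Vec d}
    (hA : Integrable A (spaceTimeMeasure d T)) :
    Integrable (fun q => χ q.1 • A q) (spaceTimeMeasure d T) := by
  obtain ⟨C, hC⟩ := exists_bound_Ioo hχ T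
  refine Integrable.bdd_smul hA (hχ.comp continuous_fst).aestronglyMeasurable (C := C) ?_
  filter_upwards [ae_spaceTime_mem d T] with q hq using hC _ hq

lemma integrable_snd_smul {A : ℝ × Phase d → Vec d} (hA : Integrable A (spaceTimeMeasure d T))
    {c : Phase d → ℝ} (hc : Continuous c) :
    Integrable (fun q => c q.2 • A q) (spaceTimeMeasure d T) := by
  obtain ⟨C, hC⟩ := exists_bound_of_continuous hc
  exact Integrable.bdd_smul hA (hc.comp continuous_snd).aestronglyMeasurable (C := C)
    (.of_forall fun q => hC _)

lemma integrable_smul_snd {A : ℝ × Phase d → ℝ} (hA : Integrable A (spaceTimeMeasure d T))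
    {c : Phase d → Vec d} (hc : Continuous c) :
    Integrable (fun q => A q • c q.2) (spaceTimeMeasure d T) := by
  obtain ⟨C, hC⟩ := exists_bound_of_continuous hc
  exact Integrable.smul_bdd hA (hc.comp continuous_snd).aestronglyMeasurable (C := C)
    (.of_forall fun q => hC _)

/-- The rate of change of `∫ u(t) · mode` along a solution `u`, with spherical gradient `U`, of
`∂_t u + ω · ∇_x u = - ∇_ω · h + μ Δ_ω u`, before integration over phase space. -/
noncomputable def rate (μ : ℝ) (u : ℝ → Phase d → ℝ) (h U : ℝ → Phase d → Vec d)
    (k : Fin d → ℤ) (b : Bool) (I : Fin n → Option (Fin d)) (q : ℝ × Phase d) : ℝ :=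
  u q.1 q.2 * modeTransport k b I q.2 + inner ℝ (h q.1 q.2 - μ • U q.1 q.2) (modeGrad k b I q.2)

/-- Weak solutions `u`, with `u(0) = 0` and weak spherical gradient `U`, of the linear equation
`∂_t u + ω · ∇_x u = - ∇_ω · h + μ Δ_ω u` with a bounded source `h`. The difference of two weak
solutions of the nonlinear equation is of this kind. The weak formulation and the duality formula
for the weak gradient are only required for the test functions `χ(t) · mode(x, ω)`. -/
structure IsLinearWeakSolution (μ T : ℝ) (u : ℝ → Phase d → ℝ) (h U : ℝ → Phase d → Vec d) :
    Prop where
  bounded : MemLp (fun q : ℝ × Phase d => u q.1 q.2) ∞ (spaceTimeMeasure d T)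
  source_bounded : MemLp (fun q : ℝ × Phase d => h q.1 q.2) ∞ (spaceTimeMeasure d T)
  grad_memLp : MemLp (fun q : ℝ × Phase d => U q.1 q.2) 2 (spaceTimeMeasure d T)
  weakGrad : ∀ χ, IsTimeTest T χ → ∀ (n : ℕ) (k : Fin d → ℤ) b (I : Fin n → Option (Fin d)),
    ∫ q : ℝ × Phase d, χ q.1 • mode k b I q.2 • U q.1 q.2 ∂(spaceTimeMeasure d T)
      = ∫ q : ℝ × Phase d, χ q.1 • u q.1 q.2 • ((((d : ℝ) - 1) * mode k b I q.2) • (q.2.2 : Vec d)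
        - modeGrad k b I q.2) ∂(spaceTimeMeasure d T)
  weak_form : ∀ χ, IsTimeTest T χ → ∀ (n : ℕ) (k : Fin d → ℤ) b (I : Fin n → Option (Fin d)),
    ∫ q : ℝ × Phase d, (deriv χ q.1 * (u q.1 q.2 * mode k b I q.2)
      + χ q.1 * rate μ u h U k b I q) ∂(spaceTimeMeasure d T) = 0

namespace IsLinearWeakSolution

variable {μ : ℝ} {u : ℝ → Phase d → ℝ} {h U : ℝ → Phase d → Vec d}

lemma integrable (H : IsLinearWeakSolution μ T u h U) :
    Integrable (fun q : ℝ × Phase d => u q.1 q.2) (spaceTimeMeasure d T) :=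
  H.bounded.integrable (by simp)

lemma integrable_source (H : IsLinearWeakSolution μ T u h U) :
    Integrable (fun q : ℝ × Phase d => h q.1 q.2) (spaceTimeMeasure d T) :=
  H.source_bounded.integrable (by simp)

lemma integrable_grad (H : IsLinearWeakSolution μ T u h U) :
    Integrable (fun q : ℝ × Phase d => U q.1 q.2) (spaceTimeMeasure d T) :=
  H.grad_memLp.integrable (by norm_num)

lemma integrable_rate (H : IsLinearWeakSolution μ T u h U) (k : Fin d → ℤ) (b : Bool)
    (I : Fin n → Option (Fin d)) : Integrable (rate μ u h U k b I) (spaceTimeMeasure d T) :=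
  (integrable_mul_snd H.integrable (continuous_modeTransport k b I)).add
    (integrable_inner_snd (H.integrable_source.sub (H.integrable_grad.smul μ))
      (continuous_modeGrad k b I))

/-- The weak formulation tested with a single mode: `∫ u(t) · mode` is a primitive of its rate. -/
lemma ae_integral_mode (H : IsLinearWeakSolution μ T u h U) (hT : 0 < T) (k : Fin d → ℤ)
    (b : Bool) (I : Fin n → Option (Fin d)) :
    ∀ᵐ t ∂(volume.restrict (Set.Ioo 0 T)), ∫ p, u t p * mode k b I p ∂(phaseMeasure d)
      = ∫ s in 0..t, ∫ p, rate μ u h U k b I (s, p) ∂(phaseMeasure d) := by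
  refine ae_integral_slice_eq (A := fun q => u q.1 q.2 * mode k b I q.2) hT
    (integrable_mul_snd H.integrable (continuous_mode k b I)) (H.integrable_rate k b I)
    fun χ hχ => H.weak_form χ hχ n k b I

lemma sphMono_cons (i : Fin d) (I : Fin n → Option (Fin d)) (w : Vec d) :
    sphMono (Fin.cons (some i) I : Fin (n + 1) → Option (Fin d)) w = w i * sphMono I w := by
  simp [sphMono, Fin.prod_univ_succ]

lemma gradient_sphMono_cons (i : Fin d) (I : Fin n → Option (Fin d)) (w : Vec d) :
    gradient (sphMono (Fin.cons (some i) I : Fin (n + 1) → Option (Fin d))) w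
      = w i • gradient (sphMono I) w + sphMono I w • EuclideanSpace.single i (1 : ℝ) := by
  apply HasGradientAt.gradient
  have h1 : HasFDerivAt (fun w : Vec d => w i) (EuclideanSpace.proj i : Vec d →L[ℝ] ℝ) w :=
    (EuclideanSpace.proj i : Vec d →L[ℝ] ℝ).hasFDerivAt
  have h2 := h1.mul (hasGradientAt_sphMono I w).hasFDerivAt
  rw [hasGradientAt_iff_hasFDerivAt]
  convert! h2 using 1
  · funext w; exact sphMono_cons i I w
  · ext y
    simp [EuclideanSpace.inner_single_left]

set_option maxHeartbeats 800000 in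
/-- Testing the weak spherical gradient against `ω_i · mode`, in the direction `e_j`, and
antisymmetrising in `i, j` removes the curvature terms: `U` has the weak rotational derivatives
of `u`. -/
lemma ae_integral_rotComp (H : IsLinearWeakSolution μ T u h U) (k : Fin d → ℤ)
    (b : Bool) (I : Fin n → Option (Fin d)) (i j : Fin d) :
    ∀ᵐ t ∂(volume.restrict (Set.Ioo 0 T)),
      ∫ p : Phase d, (rotComp i j p.2 (U t p) * mode k b I p
        + u t p * (trig k b p.1 * sphRot i j I p.2)) ∂(phaseMeasure d) = 0 := by
  have hc : ∀ l : Fin d, Continuous fun p : Phase d => (p.2 : Vec d) l := fun l => by fun_prop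
  have hUc : ∀ l : Fin d, Integrable (fun q : ℝ × Phase d => U q.1 q.2 l) (spaceTimeMeasure d T) :=
    fun l => (EuclideanSpace.proj l : Vec d →L[ℝ] ℝ).integrable_comp H.integrable_grad
  have hrot : Continuous fun p : Phase d => trig k b p.1 * sphRot i j I p.2 :=
    ((continuous_trig k b).comp continuous_fst).mul
      ((continuous_sphRot i j I).comp (continuous_subtype_val.comp continuous_snd))
  have hUm : ∀ a l : Fin d, Integrable
      (fun q : ℝ × Phase d => U q.1 q.2 l * ((q.2.2 : Vec d) a * mode k b I q.2))
      (spaceTimeMeasure d T) := fun a l =>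
    integrable_mul_snd (hUc l) ((hc a).mul (continuous_mode k b I))
  have hur := integrable_mul_snd H.integrable hrot
  refine ae_integral_slice_eq_zero (A := fun q => rotComp i j q.2.2 (U q.1 q.2) * mode k b I q.2
    + u q.1 q.2 * (trig k b q.2.1 * sphRot i j I q.2.2)) ?_ fun χ hχ => ?_
  · refine (((hUm i j).sub (hUm j i)).add hur).congr (.of_forall fun q => ?_)
    simp only [rotComp, Pi.add_apply, Pi.sub_apply]
    ring
  -- the coordinate `l` of the duality formula with the factor `ω_a` added to the mode
  have key : ∀ a l : Fin d,
      ∫ q : ℝ × Phase d, χ q.1 * (U q.1 q.2 l * ((q.2.2 : Vec d) a * mode k b I q.2))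
        ∂(spaceTimeMeasure d T)
      = ∫ q : ℝ × Phase d, χ q.1 * (u q.1 q.2 * (((d : ℝ) - 1) *
          (trig k b q.2.1 * ((q.2.2 : Vec d) a * sphMono I q.2.2)) * (q.2.2 : Vec d) l
        - modeGrad k b (Fin.cons (some a) I : Fin (n + 1) → Option (Fin d)) q.2 l))
        ∂(spaceTimeMeasure d T) := fun a l => by
    have hi1 := integrable_time_smul hχ.1.continuous (integrable_snd_smul H.integrable_grad
      (continuous_mode k b (Fin.cons (some a) I : Fin (n + 1) → Option (Fin d))))
    have hW : Continuous fun p : Phase d =>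
        (((d : ℝ) - 1) * mode k b (Fin.cons (some a) I : Fin (n + 1) → Option (Fin d)) p)
          • (p.2 : Vec d) - modeGrad k b (Fin.cons (some a) I : Fin (n + 1) → Option (Fin d)) p :=
      Continuous.sub (Continuous.smul (continuous_const.mul (continuous_mode k b _))
        (by fun_prop)) (continuous_modeGrad k b _)
    have hi2 := integrable_time_smul hχ.1.continuous (integrable_smul_snd H.integrable hW)
    have e1 := (EuclideanSpace.proj l : Vec d →L[ℝ] ℝ).integral_comp_comm hi1
    have e2 := (EuclideanSpace.proj l : Vec d →L[ℝ] ℝ).integral_comp_comm hi2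
    have h1 := e1.trans ((congrArg (EuclideanSpace.proj l : Vec d →L[ℝ] ℝ)
      (H.weakGrad χ hχ _ k b (Fin.cons (some a) I : Fin (n + 1) → Option (Fin d)))).trans e2.symm)
    refine Eq.trans (integral_congr_ae (.of_forall fun q => ?_)) (h1.trans
      (integral_congr_ae (.of_forall fun q => ?_)))
    · simp only [PiLp.proj_apply, PiLp.smul_apply, smul_eq_mul, mode, sphMono_cons]
      ring
    · simp [mode, sphMono_cons]
  have hl : ∀ a l : Fin d, Integrable (fun q : ℝ × Phase d => χ q.1 * (U q.1 q.2 l *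
      ((q.2.2 : Vec d) a * mode k b I q.2))) (spaceTimeMeasure d T) := fun a l =>
    integrable_time_mul hχ.1.continuous (hUm a l)
  have hr : ∀ a l : Fin d, Integrable (fun q : ℝ × Phase d => χ q.1 * (u q.1 q.2 *
      (((d : ℝ) - 1) * (trig k b q.2.1 * ((q.2.2 : Vec d) a * sphMono I q.2.2)) * (q.2.2 : Vec d) l
        - modeGrad k b (Fin.cons (some a) I : Fin (n + 1) → Option (Fin d)) q.2 l)))
      (spaceTimeMeasure d T) := fun a l => by
    refine integrable_time_mul hχ.1.continuous (integrable_mul_snd H.integrable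
      (c := fun p : Phase d => ((d : ℝ) - 1) * (trig k b p.1 * ((p.2 : Vec d) a * sphMono I p.2)) *
        (p.2 : Vec d) l - modeGrad k b (Fin.cons (some a) I : Fin (n + 1) → Option (Fin d)) p l) ?_)
    have h1 : Continuous fun p : Phase d => trig k b p.1 * ((p.2 : Vec d) a * sphMono I p.2) :=
      ((continuous_trig k b).comp continuous_fst).mul ((hc a).mul
        ((continuous_sphMono I).comp (continuous_subtype_val.comp continuous_snd)))
    have h3 := (EuclideanSpace.proj l : Vec d →L[ℝ] ℝ).continuous.comp
      (continuous_modeGrad k b (Fin.cons (some a) I : Fin (n + 1) → Option (Fin d)))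
    exact ((continuous_const.mul h1).mul (hc l)).sub h3
  have hsub : ∫ q : ℝ × Phase d, χ q.1 * (rotComp i j q.2.2 (U q.1 q.2) * mode k b I q.2)
        ∂(spaceTimeMeasure d T)
      = -∫ q : ℝ × Phase d, χ q.1 * (u q.1 q.2 * (trig k b q.2.1 * sphRot i j I q.2.2))
        ∂(spaceTimeMeasure d T) := by
    have hk := congrArg₂ (· - ·) (key i j) (key j i)
    simp only at hk
    rw [← integral_sub (hl i j) (hl j i), ← integral_sub (hr i j) (hr j i)] at hk
    rw [← integral_neg]
    refine Eq.trans (integral_congr_ae (.of_forall fun q => ?_)) (hk.trans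
      (integral_congr_ae (.of_forall fun q => ?_)))
    · simp only [rotComp]; ring
    · have hd : EuclideanSpace.single i (1 : ℝ) j = EuclideanSpace.single j (1 : ℝ) i := by
        simp [eq_comm]
      simp only [modeGrad, proj, gradient_sphMono_cons, sphRot, PiLp.smul_apply, PiLp.sub_apply,
        PiLp.add_apply, smul_eq_mul, inner_add_right, inner_smul_right,
        EuclideanSpace.inner_single_right, hd]
      simp
      ring
  have hi := integrable_time_mul hχ.1.continuous hur
  have hi' : Integrable (fun q : ℝ × Phase d =>
      χ q.1 * (rotComp i j q.2.2 (U q.1 q.2) * mode k b I q.2)) (spaceTimeMeasure d T) := by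
    refine ((hl i j).sub (hl j i)).congr (.of_forall fun q => ?_)
    simp only [rotComp, Pi.sub_apply]
    ring
  simp only [mul_add]
  rw [integral_add hi' hi, hsub]
  ring

end IsLinearWeakSolution

end

/-! ### Energy of the modes -/

section

variable {d : ℕ}

instance (d : ℕ) : IsProbabilityMeasure (volume : Measure (Torus d)) := by
  rw [volume_torus]; infer_instance

/-- The real Fourier coefficients in `x` of a function on phase space, as functions of `ω`. -/
noncomputable def xCoeff (F : Phase d → ℝ) (k : Fin d → ℤ) (b : Bool) (w : Sph d) : ℝ :=
  ∫ x : Torus d, F (x, w) * trig k b x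

variable {F : Phase d → ℝ}

lemma integral_mul_mode {n : ℕ} (hF : Integrable F (phaseMeasure d)) (k : Fin d → ℤ) (b : Bool)
    (I : Fin n → Option (Fin d)) :
    ∫ p, F p * mode k b I p ∂(phaseMeasure d)
      = ∫ w, xCoeff F k b w * sphMono I w ∂(sphMeasure d) := by
  have hi := integrable_mul_continuous hF (continuous_mode k b I)
  rw [phaseMeasure, integral_prod_symm _ hi]
  refine integral_congr_ae (.of_forall fun w => ?_)
  simp only [xCoeff, mode, ← integral_mul_const]
  exact integral_congr_ae (.of_forall fun x => by ring_nf)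

lemma aestronglyMeasurable_xCoeff (hF : AEStronglyMeasurable F (phaseMeasure d)) (k : Fin d → ℤ)
    (b : Bool) : AEStronglyMeasurable (xCoeff F k b) (sphMeasure d) := by
  have : AEStronglyMeasurable (fun p => F p * trig k b p.1) (phaseMeasure d) :=
    hF.mul ((continuous_trig k b).comp continuous_fst).aestronglyMeasurable
  exact AEStronglyMeasurable.integral_prod_right' (AEStronglyMeasurable.prod_swap this)

lemma ae_memLp_slice (hF : MemLp F 2 (phaseMeasure d)) :
    ∀ᵐ w ∂(sphMeasure d), MemLp (fun x => F (x, w)) 2 volume := by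
  have h1 : Integrable (fun p => F p ^ 2) (phaseMeasure d) := hF.integrable_sq
  filter_upwards [Integrable.prod_left_ae h1,
    (AEStronglyMeasurable.prod_swap hF.aestronglyMeasurable).prodMk_left] with w hw1 hw2
  exact (memLp_two_iff_integrable_sq hw2).2 hw1

lemma ae_hasSum_xCoeff_sq (hF : MemLp F 2 (phaseMeasure d)) :
    ∀ᵐ w ∂(sphMeasure d),
      HasSum (fun k => ∑ b, xCoeff F k b w ^ 2) (∫ x : Torus d, F (x, w) ^ 2) := by
  filter_upwards [ae_memLp_slice hF] with w hw using hasSum_trig_sq hw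

lemma integrable_sum_xCoeff_sq (hF : MemLp F 2 (phaseMeasure d)) (k : Fin d → ℤ) :
    Integrable (fun w => ∑ b, xCoeff F k b w ^ 2) (sphMeasure d) := by
  refine (Integrable.integral_prod_right hF.integrable_sq).mono'
    (Finset.aestronglyMeasurable_fun_sum _ fun b _ =>
      (aestronglyMeasurable_xCoeff hF.aestronglyMeasurable k b).pow 2) ?_
  filter_upwards [ae_hasSum_xCoeff_sq hF] with w hw
  rw [Real.norm_of_nonneg (Finset.sum_nonneg fun b _ => sq_nonneg _)]
  exact le_hasSum hw k fun _ _ => Finset.sum_nonneg fun b _ => sq_nonneg _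

lemma memLp_xCoeff (hF : MemLp F 2 (phaseMeasure d)) (k : Fin d → ℤ) (b : Bool) :
    MemLp (xCoeff F k b) 2 (sphMeasure d) := by
  have hm := aestronglyMeasurable_xCoeff hF.aestronglyMeasurable k b
  refine (memLp_two_iff_integrable_sq hm).2 ((integrable_sum_xCoeff_sq hF k).mono' (hm.pow 2)
    (.of_forall fun w => ?_))
  rw [Real.norm_of_nonneg (sq_nonneg _)]
  exact Finset.single_le_sum (f := fun b => xCoeff F k b w ^ 2) (fun b _ => sq_nonneg _)
    (Finset.mem_univ b)

/-- Parseval's identity in `x`, integrated over the sphere. -/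
lemma hasSum_integral_xCoeff_sq (hF : MemLp F 2 (phaseMeasure d)) :
    HasSum (fun k => ∑ b, ∫ w, xCoeff F k b w ^ 2 ∂(sphMeasure d))
      (∫ p, F p ^ 2 ∂(phaseMeasure d)) := by
  have hint := integrable_sum_xCoeff_sq hF
  have hG : Integrable (fun w => ∫ x : Torus d, F (x, w) ^ 2) (sphMeasure d) :=
    Integrable.integral_prod_right hF.integrable_sq
  have hnn : ∀ k w, 0 ≤ ∑ b, xCoeff F k b w ^ 2 := fun k w =>
    Finset.sum_nonneg fun b _ => sq_nonneg _
  have hsum : Summable fun k => ∫ w, ‖∑ b, xCoeff F k b w ^ 2‖ ∂(sphMeasure d) := by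
    refine summable_of_sum_le (c := ∫ w, (∫ x : Torus d, F (x, w) ^ 2) ∂(sphMeasure d))
      (fun k => integral_nonneg fun w => norm_nonneg _) fun s => ?_
    simp only [Real.norm_of_nonneg (hnn _ _)]
    rw [← integral_finsetSum _ fun k _ => hint k]
    refine integral_mono_ae (integrable_finsetSum _ fun k _ => hint k) hG ?_
    filter_upwards [ae_hasSum_xCoeff_sq hF] with w hw
    exact sum_le_hasSum s (fun k _ => hnn k w) hw
  have h := hasSum_integral_of_summable_integral_norm hint hsum
  have e1 : ∀ k, ∫ w, ∑ b, xCoeff F k b w ^ 2 ∂(sphMeasure d)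
      = ∑ b, ∫ w, xCoeff F k b w ^ 2 ∂(sphMeasure d) := fun k =>
    integral_finsetSum _ fun b _ => (memLp_xCoeff hF k b).integrable_sq
  have e2 : ∫ w, ∑' k, ∑ b, xCoeff F k b w ^ 2 ∂(sphMeasure d)
      = ∫ p, F p ^ 2 ∂(phaseMeasure d) := by
    rw [phaseMeasure, integral_prod_symm _ hF.integrable_sq]
    refine integral_congr_ae ?_
    filter_upwards [ae_hasSum_xCoeff_sq hF] with w hw using hw.tsum_eq
  simpa only [e1, e2] using h

/-- The squared `L²` mass of `F` seen by the modes of wave vector `k` and degree `n`. -/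
noncomputable def modeEnergy (F : Phase d → ℝ) (n : ℕ) (k : Fin d → ℤ) : ℝ :=
  ∑ b, ∑ I : Fin n → Option (Fin d), (∫ p, F p * mode k b I p ∂(phaseMeasure d)) ^ 2

/-- Bessel's inequality for the modes. -/
lemma inv_zonalMass_mul_sum_modeEnergy_le (p₀ : Sph d) (hF : MemLp F 2 (phaseMeasure d)) (n : ℕ)
    (s : Finset (Fin d → ℤ)) :
    (zonalMass d n p₀)⁻¹ * ∑ k ∈ s, modeEnergy F n k ≤ ∫ p, F p ^ 2 ∂(phaseMeasure d) := by
  refine le_trans ?_ (sum_le_hasSum s (fun k _ => Finset.sum_nonneg fun b _ =>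
    integral_nonneg fun w => sq_nonneg _) (hasSum_integral_xCoeff_sq hF))
  rw [Finset.mul_sum]
  refine Finset.sum_le_sum fun k _ => ?_
  rw [modeEnergy, Finset.mul_sum]
  refine Finset.sum_le_sum fun b _ => ?_
  simp only [integral_mul_mode (hF.integrable (by norm_num))]
  exact inv_zonalMass_mul_sum_sq_le p₀ n (memLp_xCoeff hF k b)

lemma tendsto_inv_zonalMass_mul_sum_modeEnergy (p₀ : Sph d) (hF : MemLp F 2 (phaseMeasure d))
    (s : Finset (Fin d → ℤ)) :
    Tendsto (fun n => (zonalMass d n p₀)⁻¹ * ∑ k ∈ s, modeEnergy F n k) atTop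
      (𝓝 (∑ k ∈ s, ∑ b, ∫ w, xCoeff F k b w ^ 2 ∂(sphMeasure d))) := by
  simp only [modeEnergy, Finset.mul_sum _ _ (_⁻¹), integral_mul_mode (hF.integrable (by norm_num))]
  refine tendsto_finsetSum _ fun k _ => tendsto_finsetSum _ fun b _ => ?_
  simp only [← Finset.mul_sum]
  exact tendsto_inv_zonalMass_mul_sum_sq p₀ (memLp_xCoeff hF k b)

/-! ### Energy production at a fixed time -/

variable {n : ℕ} {v : Phase d → ℝ} {g W : Phase d → Vec d} {μ M : ℝ}

lemma integrable_rotComp {V : Phase d → Vec d} (hV : Integrable V (phaseMeasure d)) (i j : Fin d) :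
    Integrable (fun p => rotComp i j p.2 (V p)) (phaseMeasure d) := by
  have hc : ∀ l : Fin d, Continuous fun p : Phase d => (p.2 : Vec d) l := fun l => by fun_prop
  have hVl : ∀ l : Fin d, Integrable (fun p => V p l) (phaseMeasure d) := fun l =>
    (EuclideanSpace.proj l : Vec d →L[ℝ] ℝ).integrable_comp hV
  refine ((integrable_mul_continuous (hVl j) (hc i)).sub
    (integrable_mul_continuous (hVl i) (hc j))).congr (.of_forall fun p => ?_)
  simp only [rotComp, Pi.sub_apply]
  ring

lemma continuous_trig_mul_sphRot (k : Fin d → ℤ) (b : Bool) (I : Fin n → Option (Fin d))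
    (i j : Fin d) : Continuous fun p : Phase d => trig k b p.1 * sphRot i j I p.2 :=
  ((continuous_trig k b).comp continuous_fst).mul
    ((continuous_sphRot i j I).comp (continuous_subtype_val.comp continuous_snd))

/-- Rotation invariance of the zonal kernel moves the rotation field from one factor to the
other. -/
lemma sum_integral_mode_mul_sphRot {f : Phase d → ℝ} (hv : Integrable v (phaseMeasure d))
    (hf : Integrable f (phaseMeasure d)) (k : Fin d → ℤ) (b : Bool) (i j : Fin d) :
    ∑ I : Fin n → Option (Fin d), (∫ p, v p * mode k b I p ∂(phaseMeasure d))
        * (∫ p, f p * (trig k b p.1 * sphRot i j I p.2) ∂(phaseMeasure d))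
      = -∑ I : Fin n → Option (Fin d),
        (∫ p, v p * (trig k b p.1 * sphRot i j I p.2) ∂(phaseMeasure d))
        * (∫ p, f p * mode k b I p ∂(phaseMeasure d)) := by
  have hm := fun (I : Fin n → Option (Fin d)) => continuous_mode k b I
  have hr := fun (I : Fin n → Option (Fin d)) => continuous_trig_mul_sphRot k b I i j
  rw [sum_integral_mul_integral (fun I => integrable_mul_continuous hv (hm I))
      (fun I => integrable_mul_continuous hf (hr I)),
    sum_integral_mul_integral (fun I => integrable_mul_continuous hv (hr I))
      (fun I => integrable_mul_continuous hf (hm I)), ← integral_neg]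
  refine integral_congr_ae (.of_forall fun z => ?_)
  have h := sum_sphMono_mul_sphRot (n := n) i j (z.1.2 : Vec d) (z.2.2 : Vec d)
  have e1 : ∀ I : Fin n → Option (Fin d), v z.1 * mode k b I z.1 *
      (f z.2 * (trig k b z.2.1 * sphRot i j I z.2.2)) = (v z.1 * trig k b z.1.1 * f z.2 *
      trig k b z.2.1) * (sphMono I z.1.2 * sphRot i j I z.2.2) := fun I => by
    simp only [mode]; ring
  have e2 : ∀ I : Fin n → Option (Fin d), v z.1 * (trig k b z.1.1 * sphRot i j I z.1.2) *
      (f z.2 * mode k b I z.2) = (v z.1 * trig k b z.1.1 * f z.2 *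
      trig k b z.2.1) * (sphRot i j I z.1.2 * sphMono I z.2.2) := fun I => by
    simp only [mode]; ring
  simp only [e1, e2, ← Finset.mul_sum, h, mul_neg]

lemma integral_inner_modeGrad {V : Phase d → Vec d} (hV : Integrable V (phaseMeasure d))
    (k : Fin d → ℤ) (b : Bool) (I : Fin n → Option (Fin d)) :
    ∫ p, inner ℝ (V p) (modeGrad k b I p) ∂(phaseMeasure d) = 2⁻¹ * ∑ i, ∑ j,
      ∫ p, rotComp i j p.2 (V p) * (trig k b p.1 * sphRot i j I p.2) ∂(phaseMeasure d) := by
  have hi := fun i j => integrable_mul_continuous (integrable_rotComp hV i j)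
    (continuous_trig_mul_sphRot k b I i j)
  simp only [inner_modeGrad]
  rw [integral_const_mul, integral_finsetSum _ fun i _ => integrable_finsetSum _ fun j _ => hi i j]
  simp only [integral_finsetSum _ fun j _ => hi _ j]

/-- The diffusion absorbs the source: contribution of `- ∇_ω · g + μ Δ_ω v` to the energy of the
modes `(k, b)`. -/
lemma sum_integral_mode_mul_inner_le (hμ : 0 < μ) (hv : Integrable v (phaseMeasure d))
    (hg : Integrable g (phaseMeasure d)) (hW : Integrable W (phaseMeasure d)) (k : Fin d → ℤ)
    (b : Bool)
    (hrot : ∀ (I : Fin n → Option (Fin d)) i j, ∫ p : Phase d, (rotComp i j p.2 (W p) * mode k b I p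
        + v p * (trig k b p.1 * sphRot i j I p.2)) ∂(phaseMeasure d) = 0) :
    ∑ I : Fin n → Option (Fin d), (∫ p, v p * mode k b I p ∂(phaseMeasure d))
        * (∫ p, inner ℝ (g p - μ • W p) (modeGrad k b I p) ∂(phaseMeasure d))
      ≤ (8 * μ)⁻¹ * ∑ i, ∑ j, ∑ I : Fin n → Option (Fin d),
        (∫ p, rotComp i j p.2 (g p) * mode k b I p ∂(phaseMeasure d)) ^ 2 := by
  have hV : Integrable (fun p => g p - μ • W p) (phaseMeasure d) := hg.sub (hW.smul μ)
  have hgm := fun (I : Fin n → Option (Fin d)) i j =>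
    integrable_mul_continuous (integrable_rotComp hg i j) (continuous_mode k b I)
  have hWm := fun (I : Fin n → Option (Fin d)) i j =>
    integrable_mul_continuous (integrable_rotComp hW i j) (continuous_mode k b I)
  have hrot' : ∀ (I : Fin n → Option (Fin d)) i j,
      ∫ p, v p * (trig k b p.1 * sphRot i j I p.2) ∂(phaseMeasure d)
        = -∫ p : Phase d, rotComp i j p.2 (W p) * mode k b I p ∂(phaseMeasure d) := fun I i j => by
    have := hrot I i j
    rw [integral_add (hWm I i j)
      (integrable_mul_continuous hv (continuous_trig_mul_sphRot k b I i j))] at this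
    linarith
  have hVm : ∀ (I : Fin n → Option (Fin d)) i j,
      ∫ p, rotComp i j p.2 (g p - μ • W p) * mode k b I p ∂(phaseMeasure d)
        = (∫ p, rotComp i j p.2 (g p) * mode k b I p ∂(phaseMeasure d))
          - μ * ∫ p, rotComp i j p.2 (W p) * mode k b I p ∂(phaseMeasure d) := fun I i j => by
    rw [← integral_const_mul, ← integral_sub (hgm I i j) ((hWm I i j).const_mul μ)]
    refine integral_congr_ae (.of_forall fun p => ?_)
    simp only [rotComp, PiLp.sub_apply, PiLp.smul_apply, smul_eq_mul]
    ring
  have hswap := fun i j => sum_integral_mode_mul_sphRot (n := n) hv (integrable_rotComp hV i j)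
    k b i j
  simp only [integral_inner_modeGrad hV]
  have e : ∑ I : Fin n → Option (Fin d), (∫ p, v p * mode k b I p ∂(phaseMeasure d)) *
      (2⁻¹ * ∑ i, ∑ j, ∫ p, rotComp i j p.2 (g p - μ • W p) * (trig k b p.1 * sphRot i j I p.2)
        ∂(phaseMeasure d))
      = 2⁻¹ * ∑ i, ∑ j, ∑ I : Fin n → Option (Fin d), (∫ p, v p * mode k b I p ∂(phaseMeasure d)) *
        ∫ p, rotComp i j p.2 (g p - μ • W p) * (trig k b p.1 * sphRot i j I p.2)
        ∂(phaseMeasure d) := by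
    simp only [mul_left_comm _ (2⁻¹ : ℝ), ← Finset.mul_sum]
    congr 1
    simp only [Finset.mul_sum]
    rw [Finset.sum_comm]
    exact Finset.sum_congr rfl fun i _ => Finset.sum_comm
  rw [e]
  simp only [hswap, hrot', hVm, Finset.mul_sum, ← Finset.sum_neg_distrib]
  refine Finset.sum_le_sum fun i _ => Finset.sum_le_sum fun j _ => Finset.sum_le_sum fun I _ => ?_
  generalize (∫ p, rotComp i j p.2 (g p) * mode k b I p ∂(phaseMeasure d)) = γ
  generalize (∫ p, rotComp i j p.2 (W p) * mode k b I p ∂(phaseMeasure d)) = w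
  rw [← sub_nonneg]
  have : (8 * μ)⁻¹ * γ ^ 2 - 2⁻¹ * -(-w * (γ - μ * w)) = (8 * μ)⁻¹ * (γ - 2 * μ * w) ^ 2 := by
    field_simp; ring
  rw [this]
  positivity

lemma abs_trig_le (k : Fin d → ℤ) (b : Bool) (x : Torus d) : |trig k b x| ≤ 1 := by
  obtain ⟨v, rfl⟩ := toTorus_surjective x
  rw [trig_toTorus]
  cases b
  · exact Real.abs_sin_le_one _
  · exact Real.abs_cos_le_one _

lemma sum_trig_mul_trigDeriv (k : Fin d → ℤ) (x y : Torus d) :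
    ∑ b, trig k b x * trigDeriv k b y
      = trig k false x * trig k true y - trig k true x * trig k false y := by
  simp [trigDeriv]; ring

instance (d : ℕ) : BorelSpace (Phase d × Phase d) :=
  haveI : SecondCountableTopology (Phase d) := inferInstance
  Prod.borelSpace

lemma measurePreserving_phase_snd (d : ℕ) :
    MeasurePreserving (Prod.snd : Phase d → Sph d) (phaseMeasure d) (sphMeasure d) :=
  measurePreserving_snd

/-- Contribution of the transport term: after antisymmetrisation it only sees `ω_p - ω_q`
weighted by the zonal kernel. -/
lemma sum_integral_mode_mul_modeTransport_le (hvm : AEStronglyMeasurable v (phaseMeasure d))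
    (hvM : ∀ᵐ p ∂(phaseMeasure d), |v p| ≤ M) (k : Fin d → ℤ) :
    ∑ b, ∑ I : Fin n → Option (Fin d), (∫ p, v p * mode k b I p ∂(phaseMeasure d))
        * (∫ p, v p * modeTransport k b I p ∂(phaseMeasure d))
      ≤ M ^ 2 * ‖waveVec k‖ * ∫ z : Sph d × Sph d, (1 + inner ℝ (z.1 : Vec d) (z.2 : Vec d)) ^ n
          * ‖(z.1 : Vec d) - z.2‖ ∂((sphMeasure d).prod (sphMeasure d)) := by
  have hv : Integrable v (phaseMeasure d) := Integrable.of_bound hvm M hvM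
  set π := phaseMeasure d
  set S : Phase d × Phase d → ℝ := fun z =>
    trig k false z.1.1 * trig k true z.2.1 - trig k true z.1.1 * trig k false z.2.1
  set w : Phase d × Phase d → ℝ := fun z => (1 + inner ℝ (z.1.2 : Vec d) (z.2.2 : Vec d)) ^ n
  have hSc : Continuous S := by
    have := continuous_trig k
    exact ((this false).comp (continuous_fst.comp continuous_fst)).mul
      ((this true).comp (continuous_fst.comp continuous_snd)) |>.sub
      (((this true).comp (continuous_fst.comp continuous_fst)).mul
      ((this false).comp (continuous_fst.comp continuous_snd)))
  have hwc : Continuous w := by fun_prop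
  have hvv : Integrable (fun z : Phase d × Phase d => v z.1 * v z.2) (π.prod π) := hv.mul_prod hv
  have hlc : ∀ c : Phase d × Phase d → Sph d, Continuous c →
      Continuous fun z => (inner ℝ (waveVec k) (c z : Vec d) : ℝ) := fun c hc =>
    continuous_const.inner (continuous_subtype_val.comp hc)
  have hX : ∑ b, ∑ I : Fin n → Option (Fin d), (∫ p, v p * mode k b I p ∂π)
        * (∫ p, v p * modeTransport k b I p ∂π)
      = ∫ z, v z.1 * v z.2 * (w z * S z * inner ℝ (waveVec k) (z.2.2 : Vec d)) ∂(π.prod π) := by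
    rw [← Fintype.sum_prod_type' (f := fun b (I : Fin n → Option (Fin d)) =>
      (∫ p, v p * mode k b I p ∂π) * (∫ p, v p * modeTransport k b I p ∂π)),
      sum_integral_mul_integral
      (fun i : Bool × (Fin n → Option (Fin d)) =>
        integrable_mul_continuous hv (continuous_mode k i.1 i.2))
      (fun i : Bool × (Fin n → Option (Fin d)) =>
        integrable_mul_continuous hv (continuous_modeTransport k i.1 i.2))]
    refine integral_congr_ae (.of_forall fun z => ?_)
    simp only [w, S, ← sum_trig_mul_trigDeriv, ← sum_sphMono_mul]
    rw [Fintype.sum_prod_type, Finset.sum_mul_sum, Finset.sum_comm]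
    simp only [Finset.sum_mul, Finset.mul_sum]
    exact Finset.sum_congr rfl fun I _ => Finset.sum_congr rfl fun b _ => by
      simp only [mode, modeTransport]; ring
  have hi2 : Integrable (fun z => v z.1 * v z.2 *
      (w z * S z * inner ℝ (waveVec k) (z.2.2 : Vec d))) (π.prod π) :=
    integrable_mul_continuous hvv ((hwc.mul hSc).mul (hlc _ (by fun_prop)))
  have hi1 : Integrable (fun z => v z.1 * v z.2 *
      (w z * S z * inner ℝ (waveVec k) (z.1.2 : Vec d))) (π.prod π) :=
    integrable_mul_continuous hvv ((hwc.mul hSc).mul (hlc _ (by fun_prop)))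
  have hswap : ∫ z, v z.1 * v z.2 * (w z * S z * inner ℝ (waveVec k) (z.2.2 : Vec d)) ∂(π.prod π)
      = -∫ z, v z.1 * v z.2 * (w z * S z * inner ℝ (waveVec k) (z.1.2 : Vec d)) ∂(π.prod π) := by
    rw [← integral_prod_swap, ← integral_neg]
    refine integral_congr_ae (.of_forall fun z => ?_)
    simp only [Prod.fst_swap, Prod.snd_swap, w, S, real_inner_comm (z.2.2 : Vec d) (z.1.2 : Vec d)]
    ring
  have hX2 : ∫ z, v z.1 * v z.2 * (w z * S z * inner ℝ (waveVec k) (z.2.2 : Vec d)) ∂(π.prod π)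
      = ∫ z, 2⁻¹ * (v z.1 * v z.2 * (w z * S z *
        inner ℝ (waveVec k) ((z.2.2 : Vec d) - z.1.2))) ∂(π.prod π) := by
    have : ∀ z : Phase d × Phase d, v z.1 * v z.2 * (w z * S z *
        inner ℝ (waveVec k) ((z.2.2 : Vec d) - z.1.2))
        = v z.1 * v z.2 * (w z * S z * inner ℝ (waveVec k) (z.2.2 : Vec d))
          - v z.1 * v z.2 * (w z * S z * inner ℝ (waveVec k) (z.1.2 : Vec d)) := fun z => by
      rw [inner_sub_right]; ring
    rw [integral_const_mul]
    simp only [this]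
    rw [integral_sub hi2 hi1]
    linarith
  have hE : ∫ z : Sph d × Sph d, (1 + inner ℝ (z.1 : Vec d) (z.2 : Vec d)) ^ n
          * ‖(z.1 : Vec d) - z.2‖ ∂((sphMeasure d).prod (sphMeasure d))
      = ∫ z : Phase d × Phase d, w z * ‖(z.1.2 : Vec d) - z.2.2‖ ∂(π.prod π) := by
    have hmp := (measurePreserving_phase_snd d).prod (measurePreserving_phase_snd d)
    have hc : Continuous fun z : Sph d × Sph d => (1 + inner ℝ (z.1 : Vec d) (z.2 : Vec d)) ^ n
          * ‖(z.1 : Vec d) - z.2‖ := by fun_prop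
    rw [← hmp.map_eq, integral_map hmp.measurable.aemeasurable hc.aestronglyMeasurable]
    rfl
  rw [hX, hX2, hE, ← integral_const_mul]
  refine (le_abs_self _).trans ?_
  rw [← Real.norm_eq_abs]
  refine norm_integral_le_of_norm_le ?_ ?_
  · have hc : Continuous fun z : Phase d × Phase d =>
      M ^ 2 * ‖waveVec k‖ * (w z * ‖(z.1.2 : Vec d) - z.2.2‖) := by fun_prop
    exact hc.integrable_of_hasCompactSupport (.of_compactSpace _)
  · filter_upwards [Measure.quasiMeasurePreserving_fst.ae hvM,
      Measure.quasiMeasurePreserving_snd.ae hvM] with z h1 h2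
    have hM : 0 ≤ M := (abs_nonneg _).trans h1
    have hw0 : 0 ≤ w z := pow_nonneg (one_add_inner_nonneg _ _) n
    have hS : |S z| ≤ 2 := by
      refine (abs_sub _ _).trans ?_
      simp only [abs_mul]
      have := abs_trig_le k
      nlinarith [this false z.1.1, this true z.1.1, this false z.2.1, this true z.2.1,
        abs_nonneg (trig k false z.1.1), abs_nonneg (trig k true z.1.1),
        abs_nonneg (trig k false z.2.1), abs_nonneg (trig k true z.2.1)]
    have hin : |(inner ℝ (waveVec k) ((z.2.2 : Vec d) - z.1.2) : ℝ)|
        ≤ ‖waveVec k‖ * ‖(z.1.2 : Vec d) - z.2.2‖ := by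
      rw [norm_sub_rev]; exact abs_real_inner_le_norm _ _
    have hvv' : |v z.1| * |v z.2| ≤ M * M := mul_le_mul h1 h2 (abs_nonneg _) hM
    rw [Real.norm_eq_abs, abs_mul, abs_mul, abs_mul, abs_mul, abs_mul, abs_of_nonneg hw0,
      abs_of_pos (by norm_num : (0 : ℝ) < 2⁻¹)]
    have hb : |S z| * |(inner ℝ (waveVec k) ((z.2.2 : Vec d) - z.1.2) : ℝ)|
        ≤ 2 * (‖waveVec k‖ * ‖(z.1.2 : Vec d) - z.2.2‖) :=
      mul_le_mul hS hin (abs_nonneg _) (by norm_num)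
    calc 2⁻¹ * (|v z.1| * |v z.2| * (w z * |S z| *
          |(inner ℝ (waveVec k) ((z.2.2 : Vec d) - z.1.2) : ℝ)|))
        = 2⁻¹ * (|v z.1| * |v z.2|) * (w z * (|S z| *
          |(inner ℝ (waveVec k) ((z.2.2 : Vec d) - z.1.2) : ℝ)|)) := by ring
      _ ≤ 2⁻¹ * (M * M) * (w z * (2 * (‖waveVec k‖ * ‖(z.1.2 : Vec d) - z.2.2‖))) := by
          gcongr
      _ = _ := by ring

end

/-! ### The energy inequality -/

section

variable {d n : ℕ} {μ M T : ℝ}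

/-- The mass of the zonal kernel weighted by the distance of its arguments, which bounds the
commutator of averaging in `ω` with transport. -/
noncomputable def zonalSpread (d n : ℕ) : ℝ :=
  ∫ z : Sph d × Sph d, (1 + inner ℝ (z.1 : Vec d) (z.2 : Vec d)) ^ n * ‖(z.1 : Vec d) - z.2‖
    ∂((sphMeasure d).prod (sphMeasure d))

lemma tendsto_zonalSpread (p₀ : Sph d) :
    Tendsto (fun n => (zonalMass d n p₀)⁻¹ * zonalSpread d n) atTop (𝓝 0) := by
  refine (tendsto_zonalKernel_norm_sub p₀).congr fun n => ?_
  rw [zonalSpread, ← integral_const_mul]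
  exact integral_congr_ae (.of_forall fun z => by simp only [zonalKernel]; ring)

lemma memLp_rotComp {g : Phase d → Vec d} (hg : MemLp g 2 (phaseMeasure d)) (i j : Fin d) :
    MemLp (fun p => rotComp i j p.2 (g p)) 2 (phaseMeasure d) := by
  refine (hg.norm.const_mul 2).mono
    (integrable_rotComp (hg.integrable (by norm_num)) i j).aestronglyMeasurable
    (.of_forall fun p => ?_)
  refine (abs_rotComp_le i j p.2 (g p)).trans ((le_abs_self _).trans_eq ?_)
  rfl

lemma sum_integral_rotComp_sq_le {g : Phase d → Vec d} (hg : MemLp g 2 (phaseMeasure d)) :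
    ∑ i, ∑ j, ∫ p, rotComp i j p.2 (g p) ^ 2 ∂(phaseMeasure d)
      ≤ 2 * ∫ p, ‖g p‖ ^ 2 ∂(phaseMeasure d) := by
  have hi := fun i j => (memLp_rotComp hg i j).integrable_sq
  rw [← integral_const_mul]
  simp only [← integral_finsetSum _ fun j _ => hi _ j]
  rw [← integral_finsetSum _ fun i _ => integrable_finsetSum _ fun j _ => hi i j]
  exact integral_mono (integrable_finsetSum _ fun i _ => integrable_finsetSum _ fun j _ => hi i j)
    (((memLp_two_iff_integrable_sq_norm hg.aestronglyMeasurable).1 hg).const_mul 2)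
    fun p => sum_rotComp_sq_le p.2 (g p)

namespace IsLinearWeakSolution

variable {u : ℝ → Phase d → ℝ} {h U : ℝ → Phase d → Vec d}

/-- Energy production of the modes with wave vectors in `s` at a fixed time. -/
lemma sum_integral_mode_mul_rate_le (hμ : 0 < μ) (p₀ : Sph d) {t : ℝ}
    (hum : AEStronglyMeasurable (u t) (phaseMeasure d))
    (huM : ∀ᵐ p ∂(phaseMeasure d), |u t p| ≤ M)
    (hh : MemLp (h t) 2 (phaseMeasure d)) (hU : Integrable (U t) (phaseMeasure d))
    (s : Finset (Fin d → ℤ))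
    (hrot : ∀ k b (I : Fin n → Option (Fin d)) i j,
      ∫ p : Phase d, (rotComp i j p.2 (U t p) * mode k b I p
        + u t p * (trig k b p.1 * sphRot i j I p.2)) ∂(phaseMeasure d) = 0) :
    (zonalMass d n p₀)⁻¹ * ∑ k ∈ s, ∑ b, ∑ I : Fin n → Option (Fin d),
        (∫ p, u t p * mode k b I p ∂(phaseMeasure d))
          * (∫ p, rate μ u h U k b I (t, p) ∂(phaseMeasure d))
      ≤ (4 * μ)⁻¹ * ∫ p, ‖h t p‖ ^ 2 ∂(phaseMeasure d)
        + (M ^ 2 * ∑ k ∈ s, ‖waveVec k‖) * ((zonalMass d n p₀)⁻¹ * zonalSpread d n) := by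
  have hZ : 0 ≤ (zonalMass d n p₀)⁻¹ := inv_nonneg.2 (zonalMass_pos n p₀).le
  have hu : Integrable (u t) (phaseMeasure d) := Integrable.of_bound hum M huM
  have hh1 : Integrable (h t) (phaseMeasure d) := hh.integrable (by norm_num)
  have hV : Integrable (fun p => h t p - μ • U t p) (phaseMeasure d) := hh1.sub (hU.smul μ)
  have hrate : ∀ k b (I : Fin n → Option (Fin d)),
      ∫ p, rate μ u h U k b I (t, p) ∂(phaseMeasure d)
        = ∫ p, u t p * modeTransport k b I p ∂(phaseMeasure d)
          + ∫ p, inner ℝ (h t p - μ • U t p) (modeGrad k b I p) ∂(phaseMeasure d) := fun k b I => by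
    refine integral_add (integrable_mul_continuous hu (continuous_modeTransport k b I)) ?_
    obtain ⟨C, hC⟩ := exists_bound_of_continuous (continuous_modeGrad k b I)
    refine (hV.norm.mul_const C).mono' (hV.aestronglyMeasurable.inner
      (continuous_modeGrad k b I).aestronglyMeasurable) (.of_forall fun q => ?_)
    exact (norm_inner_le_norm _ _).trans (mul_le_mul_of_nonneg_left (hC _) (norm_nonneg _))
  have h1 : ∑ k ∈ s, ∑ b, ∑ I : Fin n → Option (Fin d),
        (∫ p, u t p * mode k b I p ∂(phaseMeasure d))
          * (∫ p, rate μ u h U k b I (t, p) ∂(phaseMeasure d))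
      ≤ ∑ k ∈ s, (M ^ 2 * ‖waveVec k‖ * zonalSpread d n
        + ∑ b, (8 * μ)⁻¹ * ∑ i, ∑ j, ∑ I : Fin n → Option (Fin d),
          (∫ p, rotComp i j p.2 (h t p) * mode k b I p ∂(phaseMeasure d)) ^ 2) := by
    refine Finset.sum_le_sum fun k _ => ?_
    simp only [hrate, mul_add, Finset.sum_add_distrib]
    exact add_le_add (sum_integral_mode_mul_modeTransport_le hum huM k)
      (Finset.sum_le_sum fun b _ => sum_integral_mode_mul_inner_le hμ hu hh1 hU k b
        fun I i j => hrot k b I i j)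
  have h2 : ∑ k ∈ s, ∑ b, (8 * μ)⁻¹ * ∑ i, ∑ j, ∑ I : Fin n → Option (Fin d),
          (∫ p, rotComp i j p.2 (h t p) * mode k b I p ∂(phaseMeasure d)) ^ 2
      = (8 * μ)⁻¹ * ∑ i, ∑ j, ∑ k ∈ s, modeEnergy (fun p => rotComp i j p.2 (h t p)) n k := by
    simp only [modeEnergy, ← Finset.mul_sum]
    congr 1
    rw [Finset.sum_congr rfl fun k _ => Finset.sum_comm, Finset.sum_comm]
    refine Finset.sum_congr rfl fun i _ => ?_
    rw [Finset.sum_congr rfl fun k _ => Finset.sum_comm, Finset.sum_comm]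
  have h3 : (zonalMass d n p₀)⁻¹ *
      ∑ i, ∑ j, ∑ k ∈ s, modeEnergy (fun p => rotComp i j p.2 (h t p)) n k
      ≤ 2 * ∫ p, ‖h t p‖ ^ 2 ∂(phaseMeasure d) := by
    refine le_trans ?_ (sum_integral_rotComp_sq_le hh)
    rw [Finset.mul_sum]
    refine Finset.sum_le_sum fun i _ => ?_
    rw [Finset.mul_sum]
    exact Finset.sum_le_sum fun j _ =>
      inv_zonalMass_mul_sum_modeEnergy_le p₀ (memLp_rotComp hh i j) n s
  rw [Finset.sum_add_distrib, h2, ← Finset.sum_mul, ← Finset.mul_sum] at h1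
  have h4 := mul_le_mul_of_nonneg_left h3 (by positivity : 0 ≤ (8 * μ)⁻¹)
  have h5 := mul_le_mul_of_nonneg_left h1 hZ
  have h6 : (8 * μ)⁻¹ * (2 * ∫ p, ‖h t p‖ ^ 2 ∂(phaseMeasure d))
      = (4 * μ)⁻¹ * ∫ p, ‖h t p‖ ^ 2 ∂(phaseMeasure d) := by
    field_simp; ring
  linarith

/-- The energy inequality for the linear equation. -/
theorem energy_le (H : IsLinearWeakSolution μ T u h U) (hμ : 0 < μ) (hT : 0 < T) (p₀ : Sph d) :
    ∀ᵐ t ∂(volume.restrict (Set.Ioo 0 T)), ∫ p, u t p ^ 2 ∂(phaseMeasure d)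
      ≤ (2 * μ)⁻¹ * ∫ s in Set.Ioo 0 t, ∫ p, ‖h s p‖ ^ 2 ∂(phaseMeasure d) := by
  obtain ⟨M, hM⟩ : ∃ M, ∀ᵐ q ∂(spaceTimeMeasure d T), |u q.1 q.2| ≤ M :=
    ⟨_, ae_le_lpNorm_exponent_top H.bounded⟩
  have hslice_bd : ∀ᵐ t ∂(volume.restrict (Set.Ioo 0 T)), ∀ᵐ p ∂(phaseMeasure d), |u t p| ≤ M :=
    Measure.ae_ae_of_ae_prod hM
  have hslice_m : ∀ᵐ t ∂(volume.restrict (Set.Ioo 0 T)),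
      AEStronglyMeasurable (u t) (phaseMeasure d) :=
    H.bounded.aestronglyMeasurable.prodMk_left
  have hhsq : Integrable (fun q : ℝ × Phase d => ‖h q.1 q.2‖ ^ 2) (spaceTimeMeasure d T) :=
    (memLp_two_iff_integrable_sq_norm H.source_bounded.aestronglyMeasurable).1
      (H.source_bounded.mono_exponent le_top)
  have hslice_h : ∀ᵐ t ∂(volume.restrict (Set.Ioo 0 T)), MemLp (h t) 2 (phaseMeasure d) := by
    filter_upwards [H.source_bounded.aestronglyMeasurable.prodMk_left,
      Integrable.prod_right_ae hhsq] with t h1 h2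
    exact (memLp_two_iff_integrable_sq_norm h1).2 h2
  have hslice_U : ∀ᵐ t ∂(volume.restrict (Set.Ioo 0 T)), Integrable (U t) (phaseMeasure d) :=
    Integrable.prod_right_ae H.integrable_grad
  have hrot : ∀ᵐ t ∂(volume.restrict (Set.Ioo 0 T)), ∀ n k b (I : Fin n → Option (Fin d)) i j,
      ∫ p : Phase d, (rotComp i j p.2 (U t p) * mode k b I p
        + u t p * (trig k b p.1 * sphRot i j I p.2)) ∂(phaseMeasure d) = 0 := by
    simp only [ae_all_iff]
    exact fun n k b I i j => H.ae_integral_rotComp k b I i j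
  have hode : ∀ᵐ t ∂(volume.restrict (Set.Ioo 0 T)), ∀ n k b (I : Fin n → Option (Fin d)),
      ∫ p, u t p * mode k b I p ∂(phaseMeasure d)
        = ∫ s in 0..t, ∫ p, rate μ u h U k b I (s, p) ∂(phaseMeasure d) := by
    simp only [ae_all_iff]
    exact fun n k b I => H.ae_integral_mode hT k b I
  have hh_int : IntegrableOn (fun s => ∫ p, ‖h s p‖ ^ 2 ∂(phaseMeasure d)) (Set.Ioo 0 T) :=
    Integrable.integral_prod_left hhsq
  filter_upwards [hslice_bd, hslice_m, hode, ae_restrict_mem measurableSet_Ioo]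
    with t htM htm htode ht
  have hsub : Set.Ioo 0 t ⊆ Set.Ioo 0 T := Set.Ioo_subset_Ioo_right ht.2.le
  have hut : MemLp (u t) 2 (phaseMeasure d) := MemLp.of_bound htm M htM
  -- the inequality for finitely many wave vectors and fixed degree, with the commutator error
  have hfin : ∀ (s : Finset (Fin d → ℤ)) (n : ℕ),
      (zonalMass d n p₀)⁻¹ * ∑ k ∈ s, modeEnergy (u t) n k
        ≤ (2 * μ)⁻¹ * (∫ r in Set.Ioo 0 t, ∫ p, ‖h r p‖ ^ 2 ∂(phaseMeasure d))
          + (2 * t * (M ^ 2 * ∑ k ∈ s, ‖waveVec k‖))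
            * ((zonalMass d n p₀)⁻¹ * zonalSpread d n) := by
    intro s n
    have hb : ∀ k b (I : Fin n → Option (Fin d)),
        IntegrableOn (fun r => ∫ p, rate μ u h U k b I (r, p) ∂(phaseMeasure d)) (Set.Ioo 0 T) :=
      fun k b I => Integrable.integral_prod_left (H.integrable_rate k b I)
    have hYb : ∀ k b (I : Fin n → Option (Fin d)), IntegrableOn (fun r =>
        (∫ x in 0..r, ∫ p, rate μ u h U k b I (x, p) ∂(phaseMeasure d))
          * ∫ p, rate μ u h U k b I (r, p) ∂(phaseMeasure d)) (Set.Ioo 0 t) := fun k b I => by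
      have hbi : IntervalIntegrable
          (fun r => ∫ p, rate μ u h U k b I (r, p) ∂(phaseMeasure d)) volume 0 T := by
        rw [intervalIntegrable_iff_integrableOn_Ioo_of_le hT.le]; exact hb k b I
      have hc := (hbi.absolutelyContinuousOnInterval_intervalIntegral (c := 0)
        (by simp)).continuousOn
      have := hbi.continuousOn_mul hc
      rw [intervalIntegrable_iff_integrableOn_Ioo_of_le hT.le] at this
      exact this.mono_set hsub
    have hE : ∑ k ∈ s, modeEnergy (u t) n k = 2 * ∫ r in Set.Ioo 0 t, ∑ k ∈ s, ∑ b,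
        ∑ I : Fin n → Option (Fin d),
          (∫ x in 0..r, ∫ p, rate μ u h U k b I (x, p) ∂(phaseMeasure d))
          * ∫ p, rate μ u h U k b I (r, p) ∂(phaseMeasure d) := by
      rw [integral_finsetSum _ fun k _ => integrable_finsetSum _ fun b _ =>
        integrable_finsetSum _ fun I _ => hYb k b I, Finset.mul_sum]
      refine Finset.sum_congr rfl fun k _ => ?_
      rw [integral_finsetSum _ fun b _ => integrable_finsetSum _ fun I _ => hYb k b I,
        Finset.mul_sum, modeEnergy]
      refine Finset.sum_congr rfl fun b _ => ?_
      rw [integral_finsetSum _ fun I _ => hYb k b I, Finset.mul_sum]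
      refine Finset.sum_congr rfl fun I _ => ?_
      rw [htode n k b I, sq_integral_eq (hb k b I) ht]
    rw [hE, mul_left_comm]
    have hle : ∫ r in Set.Ioo 0 t, (zonalMass d n p₀)⁻¹ * ∑ k ∈ s, ∑ b,
        ∑ I : Fin n → Option (Fin d),
          (∫ x in 0..r, ∫ p, rate μ u h U k b I (x, p) ∂(phaseMeasure d))
          * ∫ p, rate μ u h U k b I (r, p) ∂(phaseMeasure d)
        ≤ ∫ r in Set.Ioo 0 t, ((4 * μ)⁻¹ * ∫ p, ‖h r p‖ ^ 2 ∂(phaseMeasure d)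
          + (M ^ 2 * ∑ k ∈ s, ‖waveVec k‖) * ((zonalMass d n p₀)⁻¹ * zonalSpread d n)) := by
      refine integral_mono_ae (Integrable.const_mul (integrable_finsetSum _ fun k _ =>
        integrable_finsetSum _ fun b _ => integrable_finsetSum _ fun I _ => hYb k b I) _)
        (((hh_int.mono_set hsub).const_mul _).add (integrable_const _)) ?_
      have hmono : volume.restrict (Set.Ioo 0 t) ≤ volume.restrict (Set.Ioo 0 T) :=
        Measure.restrict_mono hsub le_rfl
      filter_upwards [ae_mono hmono hslice_bd, ae_mono hmono hslice_m, ae_mono hmono hslice_h,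
        ae_mono hmono hslice_U, ae_mono hmono hrot, ae_mono hmono hode] with r r1 r2 r3 r4 r5 r6
      simp only [← r6]
      exact sum_integral_mode_mul_rate_le hμ p₀ r2 r1 r3 r4 s (r5 n)
    rw [integral_add ((hh_int.mono_set hsub).const_mul _) (integrable_const _),
      integral_const_mul, integral_const_mul] at hle
    simp only [integral_const, MeasurableSet.univ, measureReal_restrict_apply, Set.univ_inter,
      Real.volume_real_Ioo_of_le ht.1.le, sub_zero, smul_eq_mul] at hle
    have h4 : ∀ x : ℝ, (2 * μ)⁻¹ * x = 2 * ((4 * μ)⁻¹ * x) := fun x => by field_simp; ring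
    rw [h4]
    linarith
  refine hasSum_le_of_sum_le (hasSum_integral_xCoeff_sq hut) fun s => ?_
  refine le_of_tendsto_of_tendsto' (tendsto_inv_zonalMass_mul_sum_modeEnergy p₀ hut s) ?_ (hfin s)
  simpa using ((tendsto_zonalSpread p₀).const_mul
    (2 * t * (M ^ 2 * ∑ k ∈ s, ‖waveVec k‖))).const_add
    ((2 * μ)⁻¹ * ∫ s in Set.Ioo 0 t, ∫ p, ‖h s p‖ ^ 2 ∂(phaseMeasure d))

end IsLinearWeakSolution

end

/-! ### Young's inequality for the convolution in `x` -/

section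

variable {d : ℕ} {T M : ℝ}

instance (d : ℕ) : (volume : Measure (Torus d)).IsNegInvariant := by
  have : (volume : Measure UnitAddCircle).IsNegInvariant := inferInstance
  infer_instance

section Young

variable {k : Torus d → ℝ}

lemma integrable_kernel_sub (hk : Integrable k volume) :
    Integrable (fun z : Torus d × Phase d => k (z.1 - z.2.1))
      ((volume : Measure (Torus d)).prod (phaseMeasure d)) := by
  have hfst : Measure.QuasiMeasurePreserving (Prod.fst : Phase d → Torus d) (phaseMeasure d)
      volume := Measure.quasiMeasurePreserving_fst
  have hm : AEStronglyMeasurable (fun z : Torus d × Phase d => k (z.1 - z.2.1))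
      ((volume : Measure (Torus d)).prod (phaseMeasure d)) :=
    hk.aestronglyMeasurable.comp_quasiMeasurePreserving
      ((quasiMeasurePreserving_sub_of_right_invariant volume volume).comp
        (QuasiMeasurePreserving.prodMap (.id volume) hfst))
  refine (integrable_prod_iff' hm).2 ⟨.of_forall fun p => hk.comp_sub_right p.1, ?_⟩
  simp only [integral_sub_right_eq_self (fun y => ‖k y‖)]
  exact integrable_const _

lemma integrable_kernel_sub_left (hk : Integrable k volume) (x : Torus d) :
    Integrable (fun p : Phase d => k (x - p.1)) (phaseMeasure d) :=
  (hk.comp_sub_left x).comp_fst _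

lemma integral_abs_kernel_sub_left (x : Torus d) :
    ∫ p : Phase d, |k (x - p.1)| ∂(phaseMeasure d)
      = (sphMeasure d).real Set.univ * ∫ y, |k y| := by
  rw [phaseMeasure, integral_fun_fst (fun y => |k (x - y)|),
    integral_sub_left_eq_self (fun y => |k y|) volume x, smul_eq_mul]

/-- The Cauchy–Schwarz inequality for a nonnegative weight, from the discriminant of
`c ↦ ∫ w (c - b)²`. -/
lemma sq_integral_mul_le {X : Type*} [MeasurableSpace X] {π : Measure X} {w b : X → ℝ}
    (hw0 : ∀ x, 0 ≤ w x) (hw : Integrable w π) (hwb : Integrable (fun x => w x * b x) π)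
    (hwbb : Integrable (fun x => w x * b x ^ 2) π) :
    (∫ x, w x * b x ∂π) ^ 2 ≤ (∫ x, w x ∂π) * ∫ x, w x * b x ^ 2 ∂π := by
  have h := discrim_le_zero (a := ∫ x, w x ∂π) (b := -2 * ∫ x, w x * b x ∂π)
    (c := ∫ x, w x * b x ^ 2 ∂π) fun c => by
      have e : ∫ x, w x * (c - b x) ^ 2 ∂π = (∫ x, w x ∂π) * (c * c)
          + (-2 * ∫ x, w x * b x ∂π) * c + ∫ x, w x * b x ^ 2 ∂π := by
        have : ∀ x, w x * (c - b x) ^ 2 = (c * c) * w x + (-2 * c) * (w x * b x) + w x * b x ^ 2 :=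
          fun x => by ring
        simp only [this]
        have i1 := hw.const_mul (c * c)
        have i2 := hwb.const_mul (-2 * c)
        have i12 : Integrable (fun x => (c * c) * w x + (-2 * c) * (w x * b x)) π := i1.add i2
        rw [integral_add i12 hwbb, integral_add i1 i2, integral_const_mul, integral_const_mul]
        ring
      rw [← e]
      exact integral_nonneg fun x => mul_nonneg (hw0 x) (sq_nonneg _)
  rw [discrim] at h
  linarith

/-- Young's inequality `‖k * v‖_{L²} ≤ C ‖k‖_{L¹} ‖v‖_{L²}` for the convolution in `x` of functions
on phase space averaged in `ω`. -/
lemma integral_sq_kernel_conv_le (hk : Integrable k volume) {v : Phase d → ℝ}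
    (hvm : AEStronglyMeasurable v (phaseMeasure d))
    (hvM : ∀ᵐ p ∂(phaseMeasure d), |v p| ≤ M) :
    Integrable (fun x : Torus d => (∫ p, |k (x - p.1)| * |v p| ∂(phaseMeasure d)) ^ 2) volume ∧
    ∫ x : Torus d, (∫ p, |k (x - p.1)| * |v p| ∂(phaseMeasure d)) ^ 2
      ≤ (sphMeasure d).real Set.univ * (∫ y, |k y|) ^ 2 * ∫ p, v p ^ 2 ∂(phaseMeasure d) := by
  set π := phaseMeasure d
  have hk2 := (integrable_kernel_sub hk).abs
  have hvM2 : ∀ᵐ p ∂π, ‖v p ^ 2‖ ≤ M ^ 2 := by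
    filter_upwards [hvM] with p hp
    rw [norm_pow]; exact pow_le_pow_left₀ (abs_nonneg _) hp 2
  have hvM1 : ∀ᵐ p ∂π, ‖|v p|‖ ≤ M := by
    filter_upwards [hvM] with p hp using by rwa [Real.norm_eq_abs, abs_abs]
  have hsnd : Measure.QuasiMeasurePreserving (Prod.snd : Torus d × Phase d → Phase d)
      ((volume : Measure (Torus d)).prod π) π := Measure.quasiMeasurePreserving_snd
  have hint : Integrable (fun z : Torus d × Phase d => |k (z.1 - z.2.1)| * v z.2 ^ 2)
      ((volume : Measure (Torus d)).prod π) :=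
    hk2.mul_bdd ((hvm.pow 2).comp_quasiMeasurePreserving hsnd) (hsnd.ae hvM2)
  have hint1 : Integrable (fun z : Torus d × Phase d => |k (z.1 - z.2.1)| * |v z.2|)
      ((volume : Measure (Torus d)).prod π) :=
    hk2.mul_bdd (hvm.norm.comp_quasiMeasurePreserving hsnd) (hsnd.ae hvM1)
  have hb := Integrable.integral_prod_left hint
  have hpt : ∀ x : Torus d, (∫ p, |k (x - p.1)| * |v p| ∂π) ^ 2
      ≤ ((sphMeasure d).real Set.univ * ∫ y, |k y|) * ∫ p, |k (x - p.1)| * v p ^ 2 ∂π := fun x => by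
    have hkx := (integrable_kernel_sub_left hk x).abs
    have := sq_integral_mul_le (π := π) (w := fun p => |k (x - p.1)|) (b := fun p => |v p|)
      (fun p => abs_nonneg _) hkx (hkx.mul_bdd hvm.norm hvM1)
      (by simpa only [sq_abs, Pi.pow_apply, π] using hkx.mul_bdd (hvm.pow 2) hvM2)
    simpa only [sq_abs, integral_abs_kernel_sub_left, π] using this
  refine ⟨hb.const_mul ((sphMeasure d).real Set.univ * ∫ y, |k y|)
    |>.mono' (hint1.aestronglyMeasurable.integral_prod_right'.pow 2)
    (.of_forall fun x => ?_), ?_⟩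
  · rw [Real.norm_of_nonneg (sq_nonneg _)]; exact hpt x
  · refine (integral_mono_of_nonneg (.of_forall fun x => sq_nonneg _) (hb.const_mul _)
      (.of_forall hpt)).trans_eq ?_
    rw [integral_const_mul, integral_integral_swap hint]
    simp only [integral_mul_const, integral_sub_right_eq_self (fun y => |k y|)]
    rw [integral_const_mul]
    ring

end Young

/-! ### Normalised and projected vectors -/

section Vectors

lemma norm_normalize_sub_le {E : Type*} [NormedAddCommGroup E] [NormedSpace ℝ E] {α : ℝ}
    (hα : 0 < α) {a b : E} (ha : α < ‖a‖) (hb : b ≠ 0) :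
    ‖‖a‖⁻¹ • a - ‖b‖⁻¹ • b‖ ≤ 2 / α * ‖a - b‖ := by
  have ha0 : 0 < ‖a‖ := hα.trans ha
  have hb0 : 0 < ‖b‖ := norm_pos_iff.2 hb
  have e : ‖a‖⁻¹ • a - ‖b‖⁻¹ • b = ‖a‖⁻¹ • (a - b) + (‖a‖⁻¹ * (‖b‖ - ‖a‖)) • (‖b‖⁻¹ • b) := by
    rw [smul_sub, smul_smul]
    have : ‖a‖⁻¹ * (‖b‖ - ‖a‖) * ‖b‖⁻¹ = ‖a‖⁻¹ - ‖b‖⁻¹ := by field_simp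
    rw [this, sub_smul]
    abel
  have h1 : |‖b‖ - ‖a‖| ≤ ‖a - b‖ := by rw [abs_sub_comm]; exact abs_norm_sub_norm_le a b
  have hinv : ‖a‖⁻¹ ≤ α⁻¹ := inv_anti₀ hα ha.le
  rw [e]
  refine (norm_add_le _ _).trans ?_
  have h2 : ‖‖b‖⁻¹ • b‖ = 1 := by rw [norm_smul, norm_inv, norm_norm, inv_mul_cancel₀ hb0.ne']
  rw [norm_smul, norm_smul, h2, mul_one, norm_mul, norm_inv, norm_norm, Real.norm_eq_abs]
  calc ‖a‖⁻¹ * ‖a - b‖ + ‖a‖⁻¹ * |‖b‖ - ‖a‖| ≤ α⁻¹ * ‖a - b‖ + α⁻¹ * ‖a - b‖ := by gcongr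
    _ = _ := by ring

lemma norm_proj_le (w : Sph d) (v : Vec d) : ‖proj w v‖ ≤ ‖v‖ := by
  have h : ‖proj w v‖ ^ 2 = ‖v‖ ^ 2 - inner ℝ (w : Vec d) v ^ 2 := by
    rw [proj, norm_sub_sq_real, inner_smul_right, norm_smul, real_inner_comm, mul_pow]
    simp
    ring
  exact le_of_sq_le_sq (by rw [h]; nlinarith [sq_nonneg (inner ℝ (w : Vec d) v)]) (norm_nonneg v)

lemma proj_sub (w a b : Vec d) : proj w (a - b) = proj w a - proj w b := by
  simp only [proj, inner_sub_right, sub_smul]; abel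

variable {ν : ℝ → ℝ} {B L : ℝ}

lemma inner_mem_Icc (w : Sph d) {v : Vec d} (hv : ‖v‖ = 1) :
    (inner ℝ (w : Vec d) v : ℝ) ∈ Set.Icc (-1) 1 := by
  have := abs_real_inner_le_norm (w : Vec d) v
  rw [hv] at this
  exact abs_le.1 (by simpa using this)

lemma norm_smul_proj_le (hB : ∀ x ∈ Set.Icc (-1 : ℝ) 1, |ν x| ≤ B) (w : Sph d) {v : Vec d}
    (hv : ‖v‖ = 1) : ‖ν (inner ℝ (w : Vec d) v) • proj w v‖ ≤ B := by
  have h := hB _ (inner_mem_Icc w hv)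
  rw [norm_smul, Real.norm_eq_abs]
  calc _ ≤ B * 1 := mul_le_mul h ((norm_proj_le w v).trans_eq hv) (norm_nonneg _)
        ((abs_nonneg _).trans h)
    _ = B := mul_one B

lemma norm_smul_proj_sub_le (hB : ∀ x ∈ Set.Icc (-1 : ℝ) 1, |ν x| ≤ B)
    (hL : ∀ x ∈ Set.Icc (-1 : ℝ) 1, ∀ y ∈ Set.Icc (-1 : ℝ) 1, |ν x - ν y| ≤ L * |x - y|)
    (hL0 : 0 ≤ L) (w : Sph d) {a b : Vec d} (ha : ‖a‖ = 1) (hb : ‖b‖ = 1) :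
    ‖ν (inner ℝ (w : Vec d) a) • proj w a - ν (inner ℝ (w : Vec d) b) • proj w b‖
      ≤ (L + B) * ‖a - b‖ := by
  have e : ν (inner ℝ (w : Vec d) a) • proj w a - ν (inner ℝ (w : Vec d) b) • proj w b
      = (ν (inner ℝ (w : Vec d) a) - ν (inner ℝ (w : Vec d) b)) • proj w a
        + ν (inner ℝ (w : Vec d) b) • proj w (a - b) := by
    rw [proj_sub, sub_smul, smul_sub]; abel
  have h1 := hL _ (inner_mem_Icc w ha) _ (inner_mem_Icc w hb)
  have h2 : |inner ℝ (w : Vec d) a - inner ℝ (w : Vec d) b| ≤ ‖a - b‖ := by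
    rw [← inner_sub_right]
    simpa using abs_real_inner_le_norm (w : Vec d) (a - b)
  have h3 := hB _ (inner_mem_Icc w hb)
  rw [e]
  refine (norm_add_le _ _).trans ?_
  rw [norm_smul, norm_smul, Real.norm_eq_abs, Real.norm_eq_abs, add_mul]
  refine add_le_add ?_ (mul_le_mul h3 (norm_proj_le w _) (norm_nonneg _) ((abs_nonneg _).trans h3))
  calc _ ≤ (L * ‖a - b‖) * 1 := mul_le_mul (h1.trans (by gcongr))
        ((norm_proj_le w a).trans_eq ha) (norm_nonneg _) (by positivity)
    _ = _ := mul_one _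

end Vectors

/-! ### The alignment force -/

section Force

variable {ν K : ℝ → ℝ} {f g : ℝ → Phase d → ℝ}

lemma aestronglyMeasurable_momentum
    (hK : Integrable (fun z : Torus d => K (torusNorm z)) volume)
    (hf : AEStronglyMeasurable (fun q : ℝ × Phase d => f q.1 q.2) (spaceTimeMeasure d T)) :
    AEStronglyMeasurable (fun q : ℝ × Phase d => momentum K f q.2.1 q.1)
      (spaceTimeMeasure d T) := by
  have hfst : Measure.QuasiMeasurePreserving (Prod.fst : Phase d → Torus d) (phaseMeasure d)
      volume := Measure.quasiMeasurePreserving_fst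
  have hsnd : Measure.QuasiMeasurePreserving (Prod.snd : ℝ × Phase d → Phase d)
      (spaceTimeMeasure d T) (phaseMeasure d) := Measure.quasiMeasurePreserving_snd
  have ht : Measure.QuasiMeasurePreserving (Prod.fst : ℝ × Phase d → ℝ)
      (spaceTimeMeasure d T) (volume.restrict (Set.Ioo 0 T)) := Measure.quasiMeasurePreserving_fst
  have h1 : AEStronglyMeasurable (fun z : (ℝ × Phase d) × Phase d =>
      K (torusNorm (z.1.2.1 - z.2.1))) ((spaceTimeMeasure d T).prod (phaseMeasure d)) :=
    hK.aestronglyMeasurable.comp_quasiMeasurePreserving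
      ((quasiMeasurePreserving_sub_of_right_invariant volume volume).comp
        (QuasiMeasurePreserving.prodMap (hfst.comp hsnd) hfst))
  have h2 : AEStronglyMeasurable (fun z : (ℝ × Phase d) × Phase d => f z.1.1 z.2)
      ((spaceTimeMeasure d T).prod (phaseMeasure d)) :=
    hf.comp_quasiMeasurePreserving (QuasiMeasurePreserving.prodMap ht (.id (phaseMeasure d)))
  have h3 : AEStronglyMeasurable (fun z : (ℝ × Phase d) × Phase d => (z.2.2 : Vec d))
      ((spaceTimeMeasure d T).prod (phaseMeasure d)) :=
    Continuous.aestronglyMeasurable (by fun_prop)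
  exact AEStronglyMeasurable.integral_prod_right' ((h1.mul h2).smul h3)

lemma norm_direction {x : Torus d} {t : ℝ} (h : momentum K f x t ≠ 0) :
    ‖direction K f x t‖ = 1 := by
  rw [direction, norm_smul, norm_inv, norm_norm, inv_mul_cancel₀ (norm_ne_zero_iff.2 h)]

lemma IsAdmissible.momentum_ne_zero (hA : IsAdmissible K T f) {t : ℝ} (ht : t ∈ Set.Ioo 0 T)
    (x : Torus d) : momentum K f x t ≠ 0 := by
  obtain ⟨α, hα, h⟩ := hA
  exact norm_pos_iff.1 (hα.trans (h x t ht))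

lemma aestronglyMeasurable_force (hν : ContinuousOn ν (Set.Icc (-1) 1))
    (hK : Integrable (fun z : Torus d => K (torusNorm z)) volume)
    (hf : AEStronglyMeasurable (fun q : ℝ × Phase d => f q.1 q.2) (spaceTimeMeasure d T))
    (hA : IsAdmissible K T f) :
    AEStronglyMeasurable (fun q : ℝ × Phase d => force ν K f q.1 q.2) (spaceTimeMeasure d T) := by
  have hJ := aestronglyMeasurable_momentum hK hf
  have hΩ : AEStronglyMeasurable (fun q : ℝ × Phase d => direction K f q.2.1 q.1)
      (spaceTimeMeasure d T) :=
    hJ.norm.aemeasurable.inv.aestronglyMeasurable.smul hJ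
  have hw : AEStronglyMeasurable (fun q : ℝ × Phase d => (q.2.2 : Vec d))
      (spaceTimeMeasure d T) := Continuous.aestronglyMeasurable (by fun_prop)
  have hin : AEStronglyMeasurable (fun q : ℝ × Phase d =>
      (inner ℝ (q.2.2 : Vec d) (direction K f q.2.1 q.1) : ℝ)) (spaceTimeMeasure d T) := hw.inner hΩ
  -- `ν` is only controlled on `[-1, 1]`, where its argument lies
  have hext : Continuous (Set.IccExtend (by norm_num : (-1 : ℝ) ≤ 1)
      ((Set.Icc (-1 : ℝ) 1).domRestrict ν)) :=
    hν.domRestrict.Icc_extend'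
  refine ((hext.comp_aestronglyMeasurable hin).smul (hΩ.sub (hin.smul hw))).congr ?_
  filter_upwards [ae_spaceTime_mem d T] with q hq
  have := inner_mem_Icc q.2.2 (norm_direction (hA.momentum_ne_zero hq q.2.1))
  simp only [force, proj, Set.IccExtend_of_mem _ _ this, Set.domRestrict_apply,
    Pi.smul_apply', Pi.sub_apply]

lemma norm_momentum_sub_le (hK : Integrable (fun z : Torus d => K (torusNorm z)) volume) {t : ℝ}
    (hfm : AEStronglyMeasurable (f t) (phaseMeasure d))
    (hfM : ∀ᵐ p ∂(phaseMeasure d), |f t p| ≤ M)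
    (hgm : AEStronglyMeasurable (g t) (phaseMeasure d))
    (hgM : ∀ᵐ p ∂(phaseMeasure d), |g t p| ≤ M) (x : Torus d) :
    ‖momentum K f x t - momentum K g x t‖
      ≤ ∫ p : Phase d, |K (torusNorm (x - p.1))| * |f t p - g t p| ∂(phaseMeasure d) := by
  have hk := integrable_kernel_sub_left hK x
  have hw : AEStronglyMeasurable (fun p : Phase d => (p.2 : Vec d)) (phaseMeasure d) :=
    Continuous.aestronglyMeasurable (by fun_prop)
  have hI : ∀ {v : Phase d → ℝ}, Integrable (fun p : Phase d => K (torusNorm (x - p.1)) * v p)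
      (phaseMeasure d) →
      Integrable (fun p : Phase d => (K (torusNorm (x - p.1)) * v p) • (p.2 : Vec d))
      (phaseMeasure d) := fun hv => hv.smul_bdd (C := 1) hw (.of_forall fun p => by simp)
  have h1 := hk.mul_bdd hfm hfM
  have h2 := hk.mul_bdd hgm hgM
  rw [momentum, momentum, ← integral_sub (hI h1) (hI h2)]
  have h3 : Integrable (fun p : Phase d => |K (torusNorm (x - p.1))| * |f t p - g t p|)
      (phaseMeasure d) := by
    refine (h1.sub h2).abs.congr (.of_forall fun p => ?_)
    simp only [Pi.sub_apply, ← abs_mul, mul_sub]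
  refine norm_integral_le_of_norm_le h3 (.of_forall fun p => ?_)
  rw [← sub_smul, norm_smul, ← mul_sub, norm_mul]
  simp

end Force

end

/-! ### The difference of two weak solutions -/

section

variable {d : ℕ} {T M : ℝ}

section

variable {ν K : ℝ → ℝ} {f g : ℝ → Phase d → ℝ}

/-- The difference of the fluxes `f F_o(f) - g F_o(g)` is Lipschitz in `f - g` in `L²`, at times
where both momenta are bounded away from zero. -/
lemma exists_integral_sq_flux_sub_le (hν : ContDiffOn ℝ ∞ ν (Set.Icc (-1) 1))
    (hK : Integrable (fun z : Torus d => K (torusNorm z)) volume)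
    (hfA : IsAdmissible K T f) (hgA : IsAdmissible K T g) (M : ℝ) :
    ∃ C : ℝ, ∀ t ∈ Set.Ioo 0 T,
      AEStronglyMeasurable (f t) (phaseMeasure d) → (∀ᵐ p ∂(phaseMeasure d), |f t p| ≤ M) →
      AEStronglyMeasurable (g t) (phaseMeasure d) → (∀ᵐ p ∂(phaseMeasure d), |g t p| ≤ M) →
      ∫ p, ‖f t p • force ν K f t p - g t p • force ν K g t p‖ ^ 2 ∂(phaseMeasure d)
        ≤ C * ∫ p, (f t p - g t p) ^ 2 ∂(phaseMeasure d) := by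
  obtain ⟨B, hB⟩ : ∃ B, ∀ x ∈ Set.Icc (-1 : ℝ) 1, |ν x| ≤ B :=
    isCompact_Icc.exists_bound_of_continuousOn hν.continuousOn
  obtain ⟨L, hL⟩ := hν.exists_lipschitzOnWith (by simp) (convex_Icc _ _) isCompact_Icc
  have hL' : ∀ x ∈ Set.Icc (-1 : ℝ) 1, ∀ y ∈ Set.Icc (-1 : ℝ) 1, |ν x - ν y| ≤ L * |x - y| :=
    fun x hx y hy => hL.dist_le_mul x hx y hy
  obtain ⟨α, hα, hfα⟩ := id hfA
  set σ := (sphMeasure d).real Set.univ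
  set κ := ∫ z : Torus d, |K (torusNorm z)|
  set c := M * ((L + B) * (2 / α))
  refine ⟨2 * B ^ 2 + 2 * c ^ 2 * (σ * (σ * κ ^ 2)), fun t ht hfm hfM hgm hgM => ?_⟩
  have huM : ∀ᵐ p ∂(phaseMeasure d), |f t p - g t p| ≤ M + M := by
    filter_upwards [hfM, hgM] with p h1 h2 using (abs_sub _ _).trans (add_le_add h1 h2)
  obtain ⟨hai, hyoung⟩ := integral_sq_kernel_conv_le hK (hfm.sub hgm) huM
  simp only [Pi.sub_apply] at hai hyoung
  set a : Torus d → ℝ := fun x =>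
    ∫ p : Phase d, |K (torusNorm (x - p.1))| * |f t p - g t p| ∂(phaseMeasure d)
  have hu2 : Integrable (fun p => (f t p - g t p) ^ 2) (phaseMeasure d) :=
    (MemLp.of_bound (hfm.sub hgm) _ huM : MemLp _ 2 _).integrable_sq
  have ha2 : Integrable (fun p : Phase d => a p.1 ^ 2) (phaseMeasure d) :=
    Integrable.comp_fst hai _
  have hB0 : 0 ≤ B := (abs_nonneg _).trans (hB 0 (by norm_num))
  have hpt : ∀ᵐ p ∂(phaseMeasure d),
      ‖f t p • force ν K f t p - g t p • force ν K g t p‖ ^ 2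
        ≤ 2 * B ^ 2 * (f t p - g t p) ^ 2 + 2 * c ^ 2 * a p.1 ^ 2 := by
    filter_upwards [hgM] with p hp
    have hM0 : 0 ≤ M := (abs_nonneg _).trans hp
    have nf := norm_direction (hfA.momentum_ne_zero ht p.1)
    have ng := norm_direction (hgA.momentum_ne_zero ht p.1)
    have e : f t p • force ν K f t p - g t p • force ν K g t p
        = (f t p - g t p) • force ν K f t p + g t p • (force ν K f t p - force ν K g t p) := by
      rw [sub_smul, smul_sub]; abel
    have hF : ‖force ν K f t p‖ ≤ B := norm_smul_proj_le hB p.2 nf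
    have hdir : ‖direction K f p.1 t - direction K g p.1 t‖ ≤ 2 / α * a p.1 :=
      (norm_normalize_sub_le hα (hfα p.1 t ht) (hgA.momentum_ne_zero ht p.1)).trans
        (mul_le_mul_of_nonneg_left (norm_momentum_sub_le hK hfm hfM hgm hgM p.1) (by positivity))
    have hFF : ‖force ν K f t p - force ν K g t p‖ ≤ (L + B) * (2 / α * a p.1) :=
      (norm_smul_proj_sub_le hB hL' L.2 p.2 nf ng).trans
        (mul_le_mul_of_nonneg_left hdir (add_nonneg L.2 hB0))
    have hn : ‖f t p • force ν K f t p - g t p • force ν K g t p‖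
        ≤ B * |f t p - g t p| + c * a p.1 := by
      rw [e]
      refine (norm_add_le _ _).trans ?_
      rw [norm_smul, norm_smul, Real.norm_eq_abs, Real.norm_eq_abs, mul_comm B]
      refine add_le_add (mul_le_mul_of_nonneg_left hF (abs_nonneg _)) ?_
      refine (mul_le_mul hp hFF (norm_nonneg _) hM0).trans_eq ?_
      simp only [c]; ring
    calc _ ≤ (B * |f t p - g t p| + c * a p.1) ^ 2 := pow_le_pow_left₀ (norm_nonneg _) hn 2
      _ ≤ 2 * ((B * |f t p - g t p|) ^ 2 + (c * a p.1) ^ 2) := by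
          nlinarith [sq_nonneg (B * |f t p - g t p| - c * a p.1)]
      _ = _ := by rw [mul_pow, mul_pow, sq_abs]; ring
  refine (integral_mono_of_nonneg (.of_forall fun p => sq_nonneg _)
    ((hu2.const_mul _).add (ha2.const_mul _)) hpt).trans ?_
  have hae : ∫ p : Phase d, a p.1 ^ 2 ∂(phaseMeasure d) = σ * ∫ x, a x ^ 2 := by
    rw [phaseMeasure, integral_fun_fst (fun x => a x ^ 2), smul_eq_mul]
  simp only [Pi.add_apply]
  rw [integral_add (hu2.const_mul _) (ha2.const_mul _), integral_const_mul, integral_const_mul, hae,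
    add_mul]
  refine add_le_add le_rfl ?_
  rw [mul_assoc (2 * c ^ 2), mul_assoc σ]
  refine mul_le_mul_of_nonneg_left (mul_le_mul_of_nonneg_left hyoung measureReal_nonneg)
    (by positivity)

variable {μ : ℝ} {f₀ : Phase d → ℝ}

/-- The flux `f F_o(f)` is bounded. -/
lemma memLp_flux (hν : ContinuousOn ν (Set.Icc (-1) 1))
    (hK : Integrable (fun z : Torus d => K (torusNorm z)) volume)
    (hf : MemLp (fun q : ℝ × Phase d => f q.1 q.2) ∞ (spaceTimeMeasure d T))
    (hA : IsAdmissible K T f) :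
    MemLp (fun q : ℝ × Phase d => f q.1 q.2 • force ν K f q.1 q.2) ∞ (spaceTimeMeasure d T) := by
  obtain ⟨B, hB⟩ : ∃ B, ∀ x ∈ Set.Icc (-1 : ℝ) 1, |ν x| ≤ B :=
    isCompact_Icc.exists_bound_of_continuousOn hν
  refine MemLp.of_bound (hf.aestronglyMeasurable.smul
    (aestronglyMeasurable_force hν hK hf.aestronglyMeasurable hA))
    (lpNorm (fun q : ℝ × Phase d => f q.1 q.2) ∞ (spaceTimeMeasure d T) * B) ?_
  filter_upwards [ae_le_lpNorm_exponent_top hf, ae_spaceTime_mem d T] with q hq ht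
  have hF : ‖force ν K f q.1 q.2‖ ≤ B :=
    norm_smul_proj_le hB q.2.2 (norm_direction (hA.momentum_ne_zero ht q.2.1))
  rw [norm_smul]
  exact mul_le_mul hq hF (norm_nonneg _) ((norm_nonneg _).trans hq)

/-- The difference of two weak solutions with the same initial datum solves a linear equation
with zero initial datum and the difference of the fluxes as a source. -/
lemma IsWeakSolution.sub (hf : IsWeakSolution μ ν K T f₀ f) (hg : IsWeakSolution μ ν K T f₀ g)
    (hν : ContinuousOn ν (Set.Icc (-1) 1))
    (hK : Integrable (fun z : Torus d => K (torusNorm z)) volume)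
    (hfA : IsAdmissible K T f) (hgA : IsAdmissible K T g) :
    ∃ U : ℝ → Phase d → Vec d, IsLinearWeakSolution μ T (fun t p => f t p - g t p)
      (fun t p => f t p • force ν K f t p - g t p • force ν K g t p) U := by
  obtain ⟨F, hF2, hFw, hFeq⟩ := hf.weak_form
  obtain ⟨G, hG2, hGw, hGeq⟩ := hg.weak_form
  have hfh := memLp_flux hν hK hf.bounded hfA
  have hgh := memLp_flux hν hK hg.bounded hgA
  have hF1 : Integrable (fun q : ℝ × Phase d => F q.1 q.2) (spaceTimeMeasure d T) :=
    hF2.integrable (by norm_num)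
  have hG1 : Integrable (fun q : ℝ × Phase d => G q.1 q.2) (spaceTimeMeasure d T) :=
    hG2.integrable (by norm_num)
  have hf1 : Integrable (fun q : ℝ × Phase d => f q.1 q.2) (spaceTimeMeasure d T) :=
    hf.bounded.integrable (by simp)
  have hg1 : Integrable (fun q : ℝ × Phase d => g q.1 q.2) (spaceTimeMeasure d T) :=
    hg.bounded.integrable (by simp)
  refine ⟨fun t p => F t p - G t p, hf.bounded.sub hg.bounded, hfh.sub hgh, hF2.sub hG2,
    fun χ hχ n k b I => ?_, fun χ hχ n k b I => ?_⟩
  · have e : ∀ {w : ℝ → Phase d → ℝ} {W : ℝ → Phase d → Vec d}, IsWeakSphereGrad T w W →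
        ∫ q : ℝ × Phase d, χ q.1 • mode k b I q.2 • W q.1 q.2 ∂(spaceTimeMeasure d T)
          = ∫ q : ℝ × Phase d, χ q.1 • w q.1 q.2 • ((((d : ℝ) - 1) * mode k b I q.2) •
            (q.2.2 : Vec d) - modeGrad k b I q.2) ∂(spaceTimeMeasure d T) := fun {w W} h => by
      refine Eq.trans (integral_congr_ae (.of_forall fun q => ?_))
        ((h _ (isTestFunction_mul hχ k b I)).trans (integral_congr_ae (.of_forall fun q => ?_)))
      · simp only [mode, smul_smul]
      · simp only [mode, sphereGrad_mul]; module
    have hW : Continuous fun p : Phase d => (((d : ℝ) - 1) * mode k b I p) • (p.2 : Vec d)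
        - modeGrad k b I p :=
      Continuous.sub (Continuous.smul (continuous_const.mul (continuous_mode k b _))
        (by fun_prop)) (continuous_modeGrad k b _)
    have hc := hχ.1.continuous
    have i1 : ∀ {W : ℝ → Phase d → Vec d},
        Integrable (fun q : ℝ × Phase d => W q.1 q.2) (spaceTimeMeasure d T) → _ := fun h =>
      integrable_time_smul hc (integrable_snd_smul h (continuous_mode k b I))
    have i2 : ∀ {w : ℝ → Phase d → ℝ},
        Integrable (fun q : ℝ × Phase d => w q.1 q.2) (spaceTimeMeasure d T) → _ := fun h =>
      integrable_time_smul hc (integrable_smul_snd h hW)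
    have h := congrArg₂ (· - ·) (e hFw) (e hGw)
    rw [← integral_sub (i1 hF1) (i1 hG1), ← integral_sub (i2 hf1) (i2 hg1)] at h
    refine Eq.trans (integral_congr_ae (.of_forall fun q => ?_))
      (h.trans (integral_congr_ae (.of_forall fun q => ?_)))
    · simp only [smul_sub]
    · simp only [← smul_sub, ← sub_smul]
  · have hχ' : Continuous (deriv χ) := hχ.1.continuous_deriv (by simp)
    have e : ∀ {w : ℝ → Phase d → ℝ} {W : ℝ → Phase d → Vec d} {c : ℝ},
        ∫ q : ℝ × Phase d, (w q.1 q.2 * timeDeriv (fun t x v => χ t * (trig k b x * sphMono I v))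
            q.1 q.2
          + w q.1 q.2 * transportDeriv (fun t x v => χ t * (trig k b x * sphMono I v)) q.1 q.2
          + w q.1 q.2 * inner ℝ (force ν K w q.1 q.2)
              (sphereGrad (fun t x v => χ t * (trig k b x * sphMono I v)) q.1 q.2)
          - μ * inner ℝ (W q.1 q.2)
              (sphereGrad (fun t x v => χ t * (trig k b x * sphMono I v)) q.1 q.2))
            ∂(spaceTimeMeasure d T) + c = 0 →
        ∫ q : ℝ × Phase d, (deriv χ q.1 * (w q.1 q.2 * mode k b I q.2)
          + χ q.1 * rate μ w (fun t p => w t p • force ν K w t p) W k b I q)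
            ∂(spaceTimeMeasure d T) = -c := fun {w W c} h => by
      rw [← eq_neg_iff_add_eq_zero] at h
      rw [← h]
      refine integral_congr_ae (.of_forall fun q => ?_)
      simp only [timeDeriv_mul, transportDeriv_mul, sphereGrad_mul, rate, inner_smul_right,
        inner_sub_left, inner_smul_left]
      simp
      ring
    have hi : ∀ {w : ℝ → Phase d → ℝ} {h W : ℝ → Phase d → Vec d},
        Integrable (fun q : ℝ × Phase d => w q.1 q.2) (spaceTimeMeasure d T) →
        Integrable (fun q : ℝ × Phase d => h q.1 q.2) (spaceTimeMeasure d T) →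
        Integrable (fun q : ℝ × Phase d => W q.1 q.2) (spaceTimeMeasure d T) →
        Integrable (fun q : ℝ × Phase d => deriv χ q.1 * (w q.1 q.2 * mode k b I q.2)
          + χ q.1 * rate μ w h W k b I q) (spaceTimeMeasure d T) := fun hw hh hW =>
      (integrable_time_mul hχ' (integrable_mul_snd hw (continuous_mode k b I))).add
        (integrable_time_mul hχ.1.continuous
          ((integrable_mul_snd hw (continuous_modeTransport k b I)).add
            (integrable_inner_snd (hh.sub (hW.smul μ)) (continuous_modeGrad k b I))))
    have h := congrArg₂ (· - ·) (e (hFeq _ (isTestFunction_mul hχ k b I)))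
      (e (hGeq _ (isTestFunction_mul hχ k b I)))
    simp only [sub_self] at h
    rw [← integral_sub (hi hf1 (hfh.integrable (by simp)) hF1)
      (hi hg1 (hgh.integrable (by simp)) hG1)] at h
    refine Eq.trans (integral_congr_ae (.of_forall fun q => ?_)) h
    simp only [rate, inner_sub_left, smul_sub]
    ring

end

/-! ### Grönwall's inequality -/

/-- Grönwall's inequality for an integrable function with zero initial value, assumed only at
almost every time. -/
lemma ae_eq_zero_of_le_integral {φ : ℝ → ℝ} {C : ℝ}
    (hφ : IntegrableOn φ (Set.Ioo 0 T))
    (hφ0 : ∀ᵐ t ∂(volume.restrict (Set.Ioo 0 T)), 0 ≤ φ t)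
    (h : ∀ᵐ t ∂(volume.restrict (Set.Ioo 0 T)), φ t ≤ C * ∫ s in Set.Ioo 0 t, φ s) :
    ∀ᵐ t ∂(volume.restrict (Set.Ioo 0 T)), φ t = 0 := by
  have hΦ : ∀ t ∈ Set.Ioo 0 T, ∫ s in Set.Ioo 0 t, φ s = 0 := by
    intro t ht
    have hsub : Set.Ioo 0 t ⊆ Set.Ioo 0 T := Set.Ioo_subset_Ioo_right ht.2.le
    have hmono : volume.restrict (Set.Ioo 0 t) ≤ volume.restrict (Set.Ioo 0 T) :=
      Measure.restrict_mono hsub le_rfl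
    refine le_antisymm ?_ (integral_nonneg_of_ae (ae_mono hmono hφ0))
    have hφi : IntervalIntegrable φ volume 0 t := by
      rw [intervalIntegrable_iff_integrableOn_Ioo_of_le ht.1.le]; exact hφ.mono_set hsub
    have hΦac := hφi.absolutelyContinuousOnInterval_intervalIntegral (c := 0) (by simp)
    have hE : ∀ s, HasDerivAt (fun s => Real.exp (-C * s)) (Real.exp (-C * s) * (-C)) s :=
      fun s => by simpa using ((hasDerivAt_id s).const_mul (-C)).exp
    have hEac : AbsolutelyContinuousOnInterval (fun s => Real.exp (-C * s)) 0 t :=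
      ContDiffOn.absolutelyContinuousOnInterval (ContDiff.contDiffOn (by fun_prop))
    -- the derivative of `exp (-C s) ∫_0^s φ` is nonpositive
    have hder := hEac.integral_deriv_mul_eq_sub hΦac
    simp only [intervalIntegral.integral_same, mul_zero, sub_zero] at hder
    have hle : (∫ x in 0..t, deriv (fun s => Real.exp (-C * s)) x * (∫ r in 0..x, φ r)
        + Real.exp (-C * x) * deriv (fun y => ∫ r in 0..y, φ r) x) ≤ 0 := by
      rw [intervalIntegral.integral_of_le ht.1.le, integral_Ioc_eq_integral_Ioo]
      refine integral_nonpos_of_ae ?_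
      filter_upwards [ae_mono hmono h, ae_restrict_of_ae hφi.ae_hasDerivAt_integral,
        ae_restrict_mem measurableSet_Ioo] with s h1 h2 hs
      rw [(hE s).deriv, (h2 (by rw [Set.uIcc_of_le ht.1.le]; exact Set.Ioo_subset_Icc_self hs) 0
        (by simp)).deriv, intervalIntegral.integral_of_le hs.1.le, integral_Ioc_eq_integral_Ioo]
      have := mul_le_mul_of_nonneg_left h1 (Real.exp_pos (-C * s)).le
      simp only [Pi.zero_apply]
      linarith
    rw [hder, intervalIntegral.integral_of_le ht.1.le, integral_Ioc_eq_integral_Ioo] at hle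
    exact nonpos_of_mul_nonpos_right hle (Real.exp_pos _)
  filter_upwards [h, hφ0, ae_restrict_mem measurableSet_Ioo] with t h1 h2 ht
  rw [hΦ t ht, mul_zero] at h1
  exact le_antisymm h1 h2

end

/-! ### Uniqueness -/

section

variable {d : ℕ} {μ T : ℝ} {ν K : ℝ → ℝ} {f₀ : Phase d → ℝ} {f g : ℝ → Phase d → ℝ}

/-- Uniqueness at almost every time. -/
lemma ae_ae_eq_of_isWeakSolution (hμ : 0 < μ) (hν : ContDiffOn ℝ ∞ ν (Set.Icc (-1) 1))
    (hK : Integrable (fun z : Torus d => K (torusNorm z)) volume) (hT : 0 < T)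
    (hf : IsWeakSolution μ ν K T f₀ f) (hg : IsWeakSolution μ ν K T f₀ g)
    (hfA : IsAdmissible K T f) (hgA : IsAdmissible K T g) (p₀ : Sph d) :
    ∀ᵐ t ∂(volume.restrict (Set.Ioo 0 T)), f t =ᵐ[phaseMeasure d] g t := by
  obtain ⟨U, H⟩ := hf.sub hg hν.continuousOn hK hfA hgA
  set M := max (lpNorm (fun q : ℝ × Phase d => f q.1 q.2) ∞ (spaceTimeMeasure d T))
    (lpNorm (fun q : ℝ × Phase d => g q.1 q.2) ∞ (spaceTimeMeasure d T))
  obtain ⟨C, hC⟩ := exists_integral_sq_flux_sub_le hν hK hfA hgA M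
  have slice : ∀ {w : ℝ → Phase d → ℝ},
      MemLp (fun q : ℝ × Phase d => w q.1 q.2) ∞ (spaceTimeMeasure d T) →
      lpNorm (fun q : ℝ × Phase d => w q.1 q.2) ∞ (spaceTimeMeasure d T) ≤ M →
      ∀ᵐ t ∂(volume.restrict (Set.Ioo 0 T)), AEStronglyMeasurable (w t) (phaseMeasure d) ∧
        ∀ᵐ p ∂(phaseMeasure d), |w t p| ≤ M := fun {w} hw hM => by
    filter_upwards [AEStronglyMeasurable.prodMk_left hw.aestronglyMeasurable,
      Measure.ae_ae_of_ae_prod (ae_le_lpNorm_exponent_top hw)] with t h1 h2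
    exact ⟨h1, h2.mono fun p hp => hp.trans hM⟩
  have hflux : ∀ᵐ t ∂(volume.restrict (Set.Ioo 0 T)),
      ∫ p, ‖f t p • force ν K f t p - g t p • force ν K g t p‖ ^ 2 ∂(phaseMeasure d)
        ≤ C * ∫ p, (f t p - g t p) ^ 2 ∂(phaseMeasure d) := by
    filter_upwards [slice hf.bounded (le_max_left _ _), slice hg.bounded (le_max_right _ _),
      ae_restrict_mem measurableSet_Ioo] with t h1 h2 ht
    exact hC t ht h1.1 h1.2 h2.1 h2.2
  have hu2 : Integrable (fun q : ℝ × Phase d => (f q.1 q.2 - g q.1 q.2) ^ 2)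
      (spaceTimeMeasure d T) := (H.bounded.mono_exponent (p := 2) le_top).integrable_sq
  have hh2 : Integrable (fun q : ℝ × Phase d =>
      ‖f q.1 q.2 • force ν K f q.1 q.2 - g q.1 q.2 • force ν K g q.1 q.2‖ ^ 2)
      (spaceTimeMeasure d T) :=
    (memLp_two_iff_integrable_sq_norm H.source_bounded.aestronglyMeasurable).1
      (H.source_bounded.mono_exponent le_top)
  have hφ : IntegrableOn (fun t => ∫ p, (f t p - g t p) ^ 2 ∂(phaseMeasure d)) (Set.Ioo 0 T) :=
    Integrable.integral_prod_left hu2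
  have hψ : IntegrableOn (fun t => ∫ p, ‖f t p • force ν K f t p - g t p • force ν K g t p‖ ^ 2
      ∂(phaseMeasure d)) (Set.Ioo 0 T) := Integrable.integral_prod_left hh2
  have hzero := ae_eq_zero_of_le_integral (C := (2 * μ)⁻¹ * C) hφ
    (.of_forall fun t => integral_nonneg fun p => sq_nonneg _) (by
      filter_upwards [H.energy_le hμ hT p₀, ae_restrict_mem measurableSet_Ioo] with t h1 ht
      have hsub : Set.Ioo 0 t ⊆ Set.Ioo 0 T := Set.Ioo_subset_Ioo_right ht.2.le
      refine h1.trans ?_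
      rw [mul_assoc, ← integral_const_mul C]
      exact mul_le_mul_of_nonneg_left (integral_mono_ae (hψ.mono_set hsub)
        ((hφ.mono_set hsub).const_mul C) (ae_mono (Measure.restrict_mono hsub le_rfl) hflux))
        (by positivity))
  filter_upwards [hzero, hu2.prod_right_ae] with t h0 h1
  have h2 := (integral_eq_zero_iff_of_nonneg (fun p => sq_nonneg _) h1).1 h0
  filter_upwards [h2] with p hp
  exact sub_eq_zero.1 (pow_eq_zero_iff two_ne_zero |>.1 hp)

/-- Two `L¹`-continuous curves which agree at almost every time agree at every time. -/
lemma ae_eq_of_ae_ae_eq {X : Type*} [MeasurableSpace X] {π : Measure X} {f g : ℝ → X → ℝ}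
    (hT : 0 < T)
    (hfi : ∀ t ∈ Set.Icc 0 T, Integrable (f t) π) (hgi : ∀ t ∈ Set.Icc 0 T, Integrable (g t) π)
    (hfc : ∀ t₀ ∈ Set.Icc 0 T,
      Tendsto (fun t => ∫ p, |f t p - f t₀ p| ∂π) (𝓝[Set.Icc 0 T] t₀) (𝓝 0))
    (hgc : ∀ t₀ ∈ Set.Icc 0 T,
      Tendsto (fun t => ∫ p, |g t p - g t₀ p| ∂π) (𝓝[Set.Icc 0 T] t₀) (𝓝 0))
    (h : ∀ᵐ t ∂(volume.restrict (Set.Ioo 0 T)), f t =ᵐ[π] g t) :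
    ∀ t ∈ Set.Icc 0 T, f t =ᵐ[π] g t := by
  intro t₀ ht₀
  set S := {t | t ∈ Set.Ioo 0 T → f t =ᵐ[π] g t}
  have hS : Dense S := Measure.dense_of_ae ((ae_restrict_iff' measurableSet_Ioo).1 h)
  have hcl : t₀ ∈ closure (Set.Ioo 0 T ∩ S) := by
    have h1 := closure_minimal (hS.open_subset_closure_inter (isOpen_Ioo (a := (0 : ℝ)) (b := T)))
      isClosed_closure
    rw [closure_Ioo hT.ne] at h1
    exact h1 ht₀
  have : (𝓝[Set.Ioo 0 T ∩ S] t₀).NeBot := mem_closure_iff_nhdsWithin_neBot.1 hcl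
  have hle : 𝓝[Set.Ioo 0 T ∩ S] t₀ ≤ 𝓝[Set.Icc 0 T] t₀ :=
    nhdsWithin_mono _ fun t ht => Set.Ioo_subset_Icc_self ht.1
  have hlim := ((hfc t₀ ht₀).add (hgc t₀ ht₀)).mono_left hle
  rw [add_zero] at hlim
  have hD : ∫ p, |f t₀ p - g t₀ p| ∂π ≤ 0 := by
    refine ge_of_tendsto hlim ?_
    filter_upwards [self_mem_nhdsWithin] with t ht
    have htI : t ∈ Set.Icc 0 T := Set.Ioo_subset_Icc_self ht.1
    have i1 := ((hfi t htI).sub (hfi t₀ ht₀)).abs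
    have i2 := ((hgi t htI).sub (hgi t₀ ht₀)).abs
    simp only [Pi.sub_apply] at i1 i2
    rw [← integral_add i1 i2]
    refine integral_mono_ae ((hfi t₀ ht₀).sub (hgi t₀ ht₀)).abs (i1.add i2) ?_
    filter_upwards [ht.2 ht.1] with p hp
    simp only [hp]
    rw [abs_sub_comm (g t p) (f t₀ p)]
    exact abs_sub_le _ _ _
  have h0 := (integral_eq_zero_iff_of_nonneg (fun p => abs_nonneg _)
    ((hfi t₀ ht₀).sub (hgi t₀ ht₀)).abs).1 (hD.antisymm (integral_nonneg fun p => abs_nonneg _))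
  filter_upwards [h0] with p hp
  exact sub_eq_zero.1 (abs_eq_zero.1 hp)

end

end KolmogorovVicsek

theorem theorem2p2 (d : ℕ) (μ : ℝ) (hμ : 0 < μ) (ν K : ℝ → ℝ)
    (hν : ContDiffOn ℝ ∞ ν (Set.Icc (-1) 1))
    (hK : Integrable (fun z : KolmogorovVicsek.Torus d => K (KolmogorovVicsek.torusNorm z)) volume)
    (T : ℝ) (hT : 0 < T) (f₀ : KolmogorovVicsek.Phase d → ℝ)
    (hf₀_int : Integrable f₀ (KolmogorovVicsek.phaseMeasure d))
    (hf₀_bdd : MemLp f₀ ∞ (KolmogorovVicsek.phaseMeasure d))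
    (hf₀_nonneg : ∀ᵐ p ∂(KolmogorovVicsek.phaseMeasure d), 0 ≤ f₀ p)
    (f g : ℝ → KolmogorovVicsek.Phase d → ℝ)
    (hf : KolmogorovVicsek.IsWeakSolution μ ν K T f₀ f)
    (hg : KolmogorovVicsek.IsWeakSolution μ ν K T f₀ g)
    (hfA : KolmogorovVicsek.IsAdmissible K T f)
    (hgA : KolmogorovVicsek.IsAdmissible K T g) :
    ∀ t ∈ Set.Icc 0 T, f t =ᵐ[KolmogorovVicsek.phaseMeasure d] g t := by
  -- the sphere is empty for `d = 0`, otherwise it has a point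
  rcases isEmpty_or_nonempty (KolmogorovVicsek.Sph d) with hd | ⟨⟨p₀⟩⟩
  · exact fun t _ => .of_forall fun p => isEmptyElim p
  · exact KolmogorovVicsek.ae_eq_of_ae_ae_eq hT hf.integrable hg.integrable hf.continuous
      hg.continuous (KolmogorovVicsek.ae_ae_eq_of_isWeakSolution hμ hν hK hT hf hg hfA hgA p₀)
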